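/- \textbf{Setting.} Let $T>0$, let $g:[0,T]\to[0,+\infty[$ be continuous (arrival flow at the station), let $\theta_S,\theta_1,\theta_2$ be three distinct points of the circle of length $2\pi$ (the station and two attractions), with $|\theta-\theta'|$ the length of the shortest arc, and let $c_1,c_2,c_S>0$. Labels $(w_1,w_2)\in\{0,1\}^2$ say which attractions are still to be visited ($w_i=1$). For $L\ge 0$ let $X$ be the set of quadruples $\rho=(\rho^{1,1},\rho^{0,1},\rho^{1,0},\rho^{0,0})$ of functions $[0,T]\to[0,+\infty[$ that are Lipschitz with constant $L$ and bounded by $\int_0^Tg$. For parameters $(\alpha,\beta)\in\mathbb R^4\times\mathbb R^4$ and $\rho\in X$ the congestion costs are $$\mathcal F^{w_1,w_2}(s)=\alpha_{w_1,w_2}\,\rho^{w_1,w_2}(s)+\beta_{w_1,w_2}.$$ The value functions at the significant points are, with the convention $d^2/0=+\infty$ for $d>0$, $$V(\theta_i,t,0,0)=\min\Big\{c_S,\tfrac{|\theta_S-\theta_i|^2}{2(T-t)}\Big\}+\int_t^T\mathcal F^{0,0}\,ds\qquad(i=1,2),$$ $$V(\theta_1,t,0,1)=\min\Big\{c_2+c_S+\int_t^T\mathcal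 F^{0,1}ds,\ c_2+\tfrac{|\theta_S-\theta_1|^2}{2(T-t)}+\int_t^T\mathcal F^{0,1}ds,\ \inf_{\tau\in[t,T]}\Big(\tfrac{|\theta_2-\theta_1|^2}{2(\tau-t)}+\int_t^\tau\mathcal F^{0,1}ds+V(\theta_2,\tau,0,0)\Big)\Big\},$$ symmetrically $V(\theta_2,t,1,0)$ (exchange the indices $1$ and $2$, and use $\mathcal F^{1,0}$), and $$V(\theta_S,t,1,1)=\min\Big\{c_1+c_2+\int_t^T\mathcal F^{1,1}ds,\ \inf_{\tau\in[t,T]}\Big(\tfrac{|\theta_1-\theta_S|^2}{2(\tau-t)}+\int_t^\tau\mathcal F^{1,1}ds+V(\theta_1,\tau,0,1)\Big),\ \inf_{\eta\in[t,T]}\Big(\tfrac{|\theta_2-\theta_S|^2}{2(\eta-t)}+\int_t^\eta\mathcal F^{1,1}ds+V(\theta_2,\eta,1,0)\Big)\Big\}.$$ Each term inside a minimum is a \emph{choice} (stay; go to the station, arriving at time $T$; go to an attraction, arriving at a time $\tau$ or $\eta$); a choice is optimal at time $t$ if it attains the minimum, for a choice with an arrival time together with the arrival time used. \textbf{Equilibria.}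 A mean field game equilibrium for $(\alpha,\beta)$ is a pair $(\rho,\lambda)$, where $\rho\in X$ and $\lambda\in L^\infty(0,T)^{13}$ consists of split fractions, one for each choice at each of $(\theta_S,1,1)$, $(\theta_1,0,1)$, $(\theta_2,1,0)$, $(\theta_1,0,0)$, $(\theta_2,0,0)$, that are nonnegative and sum to $1$ at each of these points for almost every $t$, such that, for suitable measurable arrival-time functions of the departure time, the following holds. (i) For almost every $t\in(0,T)$, every choice whose fraction at $t$ is not zero is optimal at $t$ (with the given arrival time, which lies in $[t,T]$). (ii) There are integrable flows $g_{01},g_{10},g_{12},g_{21}\ge 0$ of arrivals at $(\theta_1,0,1)$, $(\theta_2,1,0)$, $(\theta_2,0,0)$, $(\theta_1,0,0)$ such that, for all $t\in[0,T[$, $\int_0^tg_{01}\,ds=\int_{\{s\in[0,T]:\tau(s)\le t\}}\lambda\,g\,ds$, where $\lambda$ and $\tau$ are the fraction and the arrival time of the choice ``go to $\theta_1$'' at $(\theta_S,1,1)$; likewise $g_{10}$ is obtained from $g$ (choice ``go to $\theta_2$'' at $(\theta_S,1,1)$), $g_{12}$ from $g_{01}$ (choice ``go to $\theta_2$'' at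 $(\theta_1,0,1)$) and $g_{21}$ from $g_{10}$ (choice ``go to $\theta_1$'' at $(\theta_2,1,0)$). (iii) These flows generate $\rho$: for all $t\in[0,T]$, $\rho^{1,1}(t)=\int_0^t(g-g_{01}-g_{10})\,ds$, $\rho^{0,1}(t)=\int_0^t(g_{01}-g_{12})\,ds$, $\rho^{1,0}(t)=\int_0^t(g_{10}-g_{21})\,ds$, $\rho^{0,0}(t)=\int_0^t(g_{12}+g_{21})\,ds$. Let $\chi_{\alpha,\beta}$ be the set of the mass components $\rho$ of the equilibria for $(\alpha,\beta)$. \textbf{Theorem.} Let $\overline\rho\in X$, let $K\subset\mathbb R^4\times\mathbb R^4$ be compact and non-empty, and let $$\mathcal E(\alpha,\beta)=\inf_{\rho\in\chi_{\alpha,\beta}}\ \max_{w_1,w_2\in\{0,1\}}\ \max_{t\in[0,T]}|\rho^{w_1,w_2}(t)-\overline\rho^{w_1,w_2}(t)|\qquad(\inf\emptyset=+\infty).$$ Then there exists $(\alpha,\beta)\in K$ such that $\mathcal E(\alpha,\beta)\le\mathcal E(\alpha',\beta')$ for all $(\alpha',\beta')\in K$. -/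

import Mathlib

open Set MeasureTheory
open scoped NNReal ENNReal

noncomputable section

namespace TouristFlow

/-- The label `(w₁, w₂)` of a branch: `wᵢ = 1` if the attraction `Pᵢ` is still to be visited,
`wᵢ = 0` if it has been visited. -/
abbrev Label := Fin 2 × Fin 2

/-- The data of the model. Positions are points of the circle of length `2π`, whose distance `dist`
is the length of the shortest arc. -/
structure Model where
  /-- final horizon -/
  T : ℝ
  T_pos : 0 < T
  /-- external arrival flow at the station -/
  g : ℝ → ℝ
  g_cont : ContinuousOn g (Icc 0 T)
  g_nonneg : ∀ t ∈ Icc 0 T, 0 ≤ g t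
  /-- station and attractions -/
  θS : AddCircle (2 * Real.pi)
  θ₁ : AddCircle (2 * Real.pi)
  θ₂ : AddCircle (2 * Real.pi)
  θS_ne_θ₁ : θS ≠ θ₁
  θS_ne_θ₂ : θS ≠ θ₂
  θ₁_ne_θ₂ : θ₁ ≠ θ₂
  /-- final costs -/
  c₁ : ℝ
  c₂ : ℝ
  cS : ℝ
  c₁_pos : 0 < c₁
  c₂_pos : 0 < c₂
  cS_pos : 0 < cS

/-- The cost `∫ u² / 2` of covering the distance `d` at constant speed in a time `h`: it is
`d² / (2 h)` if `h > 0`, and `+∞` if there is no time left. -/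
def moveCost (d h : ℝ) : EReal :=
  if 0 < h then ((d ^ 2 / (2 * h) : ℝ) : EReal) else ⊤

/-- The affine congestion cost `F^w(s) = α_w ρ^w(s) + β_w`. -/
def congestion (α β : Label → ℝ) (ρ : Label → ℝ → ℝ) (w : Label) (s : ℝ) : ℝ :=
  α w * ρ w s + β w

namespace Model

variable (M : Model)

/-! ### Costs of the choices at the significant points, and value functions

`F w s` is the congestion cost on the branch `w` at the time `s`. -/

/-- At `(θ, 0, 0)` at time `t`: not moving. -/
def stay00 (F : Label → ℝ → ℝ) (t : ℝ) : EReal :=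
  ((M.cS + ∫ s in t..M.T, F (0, 0) s : ℝ) : EReal)

/-- At `(θ, 0, 0)` at time `t`: reaching the station at time `T`. -/
def home00 (F : Label → ℝ → ℝ) (θ : AddCircle (2 * Real.pi)) (t : ℝ) : EReal :=
  moveCost (dist θ M.θS) (M.T - t) + ((∫ s in t..M.T, F (0, 0) s : ℝ) : EReal)

/-- `V(θ, t, 0, 0)`. -/
def V00 (F : Label → ℝ → ℝ) (θ : AddCircle (2 * Real.pi)) (t : ℝ) : EReal :=
  min (M.stay00 F t) (M.home00 F θ t)

/-- On a branch `w` with one attraction still to be visited, whose missing costs `c`: not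
moving. -/
def stayOne (F : Label → ℝ → ℝ) (w : Label) (c : ℝ) (t : ℝ) : EReal :=
  ((c + M.cS + ∫ s in t..M.T, F w s : ℝ) : EReal)

/-- On such a branch, from `θ` at time `t`: reaching the station at time `T`. -/
def homeOne (F : Label → ℝ → ℝ) (w : Label) (c : ℝ) (θ : AddCircle (2 * Real.pi)) (t : ℝ) :
    EReal :=
  (c : EReal) + moveCost (dist θ M.θS) (M.T - t) + ((∫ s in t..M.T, F w s : ℝ) : EReal)

/-- On such a branch, from `θ` at time `t`: reaching the attraction `θ'` at time `τ` and going on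
optimally from there. -/
def visitOne (F : Label → ℝ → ℝ) (w : Label) (θ θ' : AddCircle (2 * Real.pi)) (t τ : ℝ) : EReal :=
  moveCost (dist θ θ') (τ - t) + ((∫ s in t..τ, F w s : ℝ) : EReal) + M.V00 F θ' τ

/-- The value function on such a branch. -/
def VOne (F : Label → ℝ → ℝ) (w : Label) (c : ℝ) (θ θ' : AddCircle (2 * Real.pi)) (t : ℝ) :
    EReal :=
  min (M.stayOne F w c t) (min (M.homeOne F w c θ t)
    (⨅ τ ∈ Icc t M.T, M.visitOne F w θ θ' t τ))

/-- `V(θ₁, t, 0, 1)`. -/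
def V01 (F : Label → ℝ → ℝ) (t : ℝ) : EReal := M.VOne F (0, 1) M.c₂ M.θ₁ M.θ₂ t

/-- `V(θ₂, t, 1, 0)`. -/
def V10 (F : Label → ℝ → ℝ) (t : ℝ) : EReal := M.VOne F (1, 0) M.c₁ M.θ₂ M.θ₁ t

/-- At `(θS, 1, 1)` at time `t`: not moving. -/
def stay11 (F : Label → ℝ → ℝ) (t : ℝ) : EReal :=
  ((M.c₁ + M.c₂ + ∫ s in t..M.T, F (1, 1) s : ℝ) : EReal)

/-- At `(θS, 1, 1)` at time `t`: reaching `θ₁` at time `τ` and going on optimally. -/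
def visit11_1 (F : Label → ℝ → ℝ) (t τ : ℝ) : EReal :=
  moveCost (dist M.θS M.θ₁) (τ - t) + ((∫ s in t..τ, F (1, 1) s : ℝ) : EReal) + M.V01 F τ

/-- At `(θS, 1, 1)` at time `t`: reaching `θ₂` at time `η` and going on optimally. -/
def visit11_2 (F : Label → ℝ → ℝ) (t η : ℝ) : EReal :=
  moveCost (dist M.θS M.θ₂) (η - t) + ((∫ s in t..η, F (1, 1) s : ℝ) : EReal) + M.V10 F η

/-- `V(θS, t, 1, 1)`. -/
def V11 (F : Label → ℝ → ℝ) (t : ℝ) : EReal :=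
  min (M.stay11 F t) (min (⨅ τ ∈ Icc t M.T, M.visit11_1 F t τ)
    (⨅ η ∈ Icc t M.T, M.visit11_2 F t η))

/-! ### Mass profiles, split fractions and flows -/

/-- The set `X` of the quadruples of functions `[0, T] → [0, +∞[` that are Lipschitz with constant
`L` and bounded by the total mass `∫₀ᵀ g`. -/
def X (L : ℝ≥0) : Set (Label → ℝ → ℝ) :=
  {ρ | ∀ w, LipschitzOnWith L (ρ w) (Icc 0 M.T) ∧
    ∀ t ∈ Icc 0 M.T, 0 ≤ ρ w t ∧ ρ w t ≤ ∫ s in (0 : ℝ)..M.T, M.g s}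

/-- `lam` splits an arrival flow into the fractions making each of `k` choices. -/
def IsSplit {k : ℕ} (lam : Fin k → ℝ → ℝ) : Prop :=
  (∀ i, Measurable (lam i)) ∧
    ∀ᵐ t ∂(volume.restrict (Ioo 0 M.T)), (∀ i, 0 ≤ lam i t) ∧ ∑ i, lam i t = 1

/-- `q` is the flow (density in time) of arrivals at a point, when agents departing with density
`f` (in the departure time) take the times `τ` to arrive: the mass arrived by the time `t` is the
mass that departed at those `s` with `τ s ≤ t`. The identity is asked for before the final instant
`T` only, so agents who plan to arrive exactly at `T` do not contribute to the density. -/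
def IsArrivalFlow (f τ q : ℝ → ℝ) : Prop :=
  IntegrableOn q (Icc 0 M.T) ∧ (∀ᵐ t ∂(volume.restrict (Ioo 0 M.T)), 0 ≤ q t) ∧
    ∀ t ∈ Ico 0 M.T, ∫ s in (0 : ℝ)..t, q s = ∫ s in Icc 0 M.T ∩ {s | τ s ≤ t}, f s

end Model

/-- The string of the 13 split functions, one group for each significant point. -/
structure SplitString where
  /-- at `(θS, 1, 1)`: stay, go to `θ₁`, go to `θ₂` -/
  atS11 : Fin 3 → ℝ → ℝ
  /-- at `(θ₁, 0, 1)`: stay, go to the station, go to `θ₂` -/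
  at101 : Fin 3 → ℝ → ℝ
  /-- at `(θ₂, 1, 0)`: stay, go to the station, go to `θ₁` -/
  at210 : Fin 3 → ℝ → ℝ
  /-- at `(θ₁, 0, 0)`: stay, go to the station -/
  at100 : Fin 2 → ℝ → ℝ
  /-- at `(θ₂, 0, 0)`: stay, go to the station -/
  at200 : Fin 2 → ℝ → ℝ

namespace Model

variable (M : Model)

/-- All five groups of functions are split fractions. -/
structure IsSplitString (lam : SplitString) : Prop where
  atS11 : M.IsSplit lam.atS11
  at101 : M.IsSplit lam.at101
  at210 : M.IsSplit lam.at210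
  at100 : M.IsSplit lam.at100
  at200 : M.IsSplit lam.at200

/-- For the congestion costs `F`, at almost every instant every choice that is made by a nonzero
fraction is optimal; `τ₁, τ₂` are the arrival times (at `θ₁`, `θ₂`) of the agents who leave the
station at time `t`, and `τ₁₂, τ₂₁` those of the agents who go from `θ₁` to `θ₂` and from `θ₂` to
`θ₁`. -/
structure IsOptimal (F : Label → ℝ → ℝ) (lam : SplitString) (τ₁ τ₂ τ₁₂ τ₂₁ : ℝ → ℝ) : Prop where
  atS11 : ∀ᵐ t ∂(volume.restrict (Ioo 0 M.T)),
    (lam.atS11 0 t ≠ 0 → M.stay11 F t = M.V11 F t) ∧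
    (lam.atS11 1 t ≠ 0 → τ₁ t ∈ Icc t M.T ∧ M.visit11_1 F t (τ₁ t) = M.V11 F t) ∧
    (lam.atS11 2 t ≠ 0 → τ₂ t ∈ Icc t M.T ∧ M.visit11_2 F t (τ₂ t) = M.V11 F t)
  at101 : ∀ᵐ t ∂(volume.restrict (Ioo 0 M.T)),
    (lam.at101 0 t ≠ 0 → M.stayOne F (0, 1) M.c₂ t = M.V01 F t) ∧
    (lam.at101 1 t ≠ 0 → M.homeOne F (0, 1) M.c₂ M.θ₁ t = M.V01 F t) ∧
    (lam.at101 2 t ≠ 0 → τ₁₂ t ∈ Icc t M.T ∧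
      M.visitOne F (0, 1) M.θ₁ M.θ₂ t (τ₁₂ t) = M.V01 F t)
  at210 : ∀ᵐ t ∂(volume.restrict (Ioo 0 M.T)),
    (lam.at210 0 t ≠ 0 → M.stayOne F (1, 0) M.c₁ t = M.V10 F t) ∧
    (lam.at210 1 t ≠ 0 → M.homeOne F (1, 0) M.c₁ M.θ₂ t = M.V10 F t) ∧
    (lam.at210 2 t ≠ 0 → τ₂₁ t ∈ Icc t M.T ∧
      M.visitOne F (1, 0) M.θ₂ M.θ₁ t (τ₂₁ t) = M.V10 F t)
  at100 : ∀ᵐ t ∂(volume.restrict (Ioo 0 M.T)),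
    (lam.at100 0 t ≠ 0 → M.stay00 F t = M.V00 F M.θ₁ t) ∧
    (lam.at100 1 t ≠ 0 → M.home00 F M.θ₁ t = M.V00 F M.θ₁ t)
  at200 : ∀ᵐ t ∂(volume.restrict (Ioo 0 M.T)),
    (lam.at200 0 t ≠ 0 → M.stay00 F t = M.V00 F M.θ₂ t) ∧
    (lam.at200 1 t ≠ 0 → M.home00 F M.θ₂ t = M.V00 F M.θ₂ t)

/-- Starting from the external flow `g`, the split fractions `lam` and the arrival times generate
the flows `g₀₁` into `(θ₁, 0, 1)`, `g₁₀` into `(θ₂, 1, 0)`, `g₁₂` into `(θ₂, 0, 0)` and `g₂₁` into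
`(θ₁, 0, 0)`, and these flows generate the masses `ρ` on the four branches. -/
structure Generates (lam : SplitString) (τ₁ τ₂ τ₁₂ τ₂₁ g₀₁ g₁₀ g₁₂ g₂₁ : ℝ → ℝ)
    (ρ : Label → ℝ → ℝ) : Prop where
  flow01 : M.IsArrivalFlow (fun s => lam.atS11 1 s * M.g s) τ₁ g₀₁
  flow10 : M.IsArrivalFlow (fun s => lam.atS11 2 s * M.g s) τ₂ g₁₀
  flow12 : M.IsArrivalFlow (fun s => lam.at101 2 s * g₀₁ s) τ₁₂ g₁₂
  flow21 : M.IsArrivalFlow (fun s => lam.at210 2 s * g₁₀ s) τ₂₁ g₂₁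
  mass11 : ∀ t ∈ Icc 0 M.T, ρ (1, 1) t =
    (∫ s in (0 : ℝ)..t, M.g s) - (∫ s in (0 : ℝ)..t, g₀₁ s) - ∫ s in (0 : ℝ)..t, g₁₀ s
  mass01 : ∀ t ∈ Icc 0 M.T, ρ (0, 1) t =
    (∫ s in (0 : ℝ)..t, g₀₁ s) - ∫ s in (0 : ℝ)..t, g₁₂ s
  mass10 : ∀ t ∈ Icc 0 M.T, ρ (1, 0) t =
    (∫ s in (0 : ℝ)..t, g₁₀ s) - ∫ s in (0 : ℝ)..t, g₂₁ s
  mass00 : ∀ t ∈ Icc 0 M.T, ρ (0, 0) t =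
    (∫ s in (0 : ℝ)..t, g₁₂ s) + ∫ s in (0 : ℝ)..t, g₂₁ s

/-- `(ρ, lam)` is a mean field game equilibrium for the congestion costs with parameters `α, β`. -/
def IsEquilibrium (L : ℝ≥0) (α β : Label → ℝ) (ρ : Label → ℝ → ℝ) (lam : SplitString) : Prop :=
  ρ ∈ M.X L ∧ M.IsSplitString lam ∧
    ∃ τ₁ τ₂ τ₁₂ τ₂₁ g₀₁ g₁₀ g₁₂ g₂₁ : ℝ → ℝ,
      Measurable τ₁ ∧ Measurable τ₂ ∧ Measurable τ₁₂ ∧ Measurable τ₂₁ ∧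
      M.IsOptimal (congestion α β ρ) lam τ₁ τ₂ τ₁₂ τ₂₁ ∧
      M.Generates lam τ₁ τ₂ τ₁₂ τ₂₁ g₀₁ g₁₀ g₁₂ g₂₁ ρ

/-- The set of the mass components of the equilibria for the parameters `α, β`. -/
def equilibria (L : ℝ≥0) (α β : Label → ℝ) : Set (Label → ℝ → ℝ) :=
  {ρ | ∃ lam, M.IsEquilibrium L α β ρ lam}

/-- The uniform distance on `[0, T]` of two quadruples of functions. -/
def uniformDist (ρ ρ' : Label → ℝ → ℝ) : ℝ≥0∞ :=
  ⨆ w : Label, ⨆ t ∈ Icc 0 M.T, ENNReal.ofReal |ρ w t - ρ' w t|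

/-- The controller's cost: the infimum over the equilibria of the uniform distance from the
reference `ρbar` (`+∞` if there is no equilibrium). -/
def controllerCost (L : ℝ≥0) (ρbar : Label → ℝ → ℝ) (α β : Label → ℝ) : ℝ≥0∞ :=
  ⨅ ρ ∈ M.equilibria L α β, M.uniformDist ρ ρbar

end Model

end TouristFlow

end

/-!
# Optimal congestion parameters exist

The set `X` of mass profiles is compact for the uniform distance (Arzelà–Ascoli,
`exists_subseq_uniform`), so a minimizing sequence of parameters and equilibrium masses has a
subsequence along which both converge. What carries the result is that the equilibrium
correspondence has a closed graph (`mem_equilibria_of_tendsto`): the limit masses are equilibrium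
masses for the limit parameters, and their distance from the reference does not exceed the infimum.

Let equilibria `ρ n` converge uniformly to `ρ₀`. The Lipschitz constant of the masses bounds the
flows in `L^∞` (`ae_flow_le`), so that flows and split fractions have weak-* limits, taken here
along an ultrafilter (`exists_setTendsto`, `exists_split_limit`). Products of fractions and flows do
not converge to the products of the limits; the limit fractions are instead the densities of the
limits of the products with respect to the limit flow. All costs depend uniformly continuously on
the congestion (`NearCosts`), and a limit fraction vanishes almost everywhere on the set where the
approximating fractions vanish eventually (`ae_frequently_ne_zero`). Hence a choice made in the
limit is optimal for infinitely many approximating problems, and so in the limit.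

A weak limit of arrival flows could spread the agents leaving at one time over several arrival
times. This does not happen, because the travel cost `d² / (2 (τ - t))` is strictly submodular in
`(t, τ)`: best arrival times increase with the departure time, so they are unique for all but
countably many departures (`exists_measurable_bestArrival`), and the arrival times in use converge
almost everywhere (`exists_limit_bestArrival`). The transport of the flows then passes to the limit
(`isArrivalFlow_of_setTendsto`).
-/

namespace TouristFlow

open Filter Topology

/-! ### Setwise convergence of bounded densities -/

section SetwiseConvergence

variable {Ω : Type*} [MeasurableSpace Ω] {μ : Measure Ω}

/-- Setwise convergence of densities along a filter: the integrals over every measurable set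
converge. For densities with a common bound and a finite measure this is weak-* convergence in
`L^∞`. -/
def SetTendsto (l : Filter ℕ) (μ : Measure Ω) (h : ℕ → Ω → ℝ) (k : Ω → ℝ) : Prop :=
  ∀ A, MeasurableSet A → Tendsto (fun n => ∫ x in A, h n x ∂μ) l (𝓝 (∫ x in A, k x ∂μ))

lemma SetTendsto.congr_limit {l : Filter ℕ} {h : ℕ → Ω → ℝ} {k k' : Ω → ℝ}
    (hk : SetTendsto l μ h k) (hkk' : k =ᵐ[μ] k') : SetTendsto l μ h k' := by
  intro A hA
  rw [← setIntegral_congr_ae (g := k') hA (f := k) (hkk'.mono fun x hx _ => hx)]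
  exact hk A hA

lemma integrable_of_ae_mem_Icc [IsFiniteMeasure μ] {f : Ω → ℝ} {B : ℝ}
    (hm : AEStronglyMeasurable f μ) (h0 : ∀ᵐ x ∂μ, 0 ≤ f x ∧ f x ≤ B) : Integrable f μ :=
  Integrable.of_bound hm B (h0.mono fun x hx => by
    rw [Real.norm_of_nonneg hx.1]; exact hx.2)

/-- Weak-* compactness of bounded sets of densities, along an ultrafilter: Banach–Alaoglu in
`L²`, where the dual space is identified with `L²` itself. -/
theorem exists_setTendsto [IsFiniteMeasure μ] (U : Ultrafilter ℕ) {h : ℕ → Ω → ℝ} {B : ℝ}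
    (hm : ∀ n, AEStronglyMeasurable (h n) μ) (h0 : ∀ n, ∀ᵐ x ∂μ, 0 ≤ h n x ∧ h n x ≤ B) :
    ∃ k : Ω → ℝ, Measurable k ∧ (∀ᵐ x ∂μ, 0 ≤ k x ∧ k x ≤ B) ∧ SetTendsto U μ h k := by
  have hb : ∀ n, ∀ᵐ x ∂μ, ‖h n x‖ ≤ B := fun n => (h0 n).mono fun x hx => by
    rw [Real.norm_of_nonneg hx.1]; exact hx.2
  have hLp : ∀ n, MemLp (h n) 2 μ := fun n => MemLp.of_bound (hm n) B (hb n)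
  let f : ℕ → Lp ℝ 2 μ := fun n => (hLp n).toLp
  obtain ⟨R, hR⟩ : ∃ R : ℝ, ∀ n, ‖f n‖ ≤ R := by
    refine ⟨(μ univ).toReal ^ (ENNReal.toReal 2)⁻¹ * |B|, fun n => ?_⟩
    refine Lp.norm_le_of_ae_bound (abs_nonneg B) ?_
    filter_upwards [(hLp n).coeFn_toLp, hb n] with x hx hx'
    rw [hx]; exact hx'.trans (le_abs_self B)
  let φ : ℕ → WeakDual ℝ (Lp ℝ 2 μ) := fun n =>
    StrongDual.toWeakDual (InnerProductSpace.toDual ℝ (Lp ℝ 2 μ) (f n))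
  have hφ : ∀ n, φ n ∈ WeakDual.toStrongDual ⁻¹'
      Metric.closedBall (0 : StrongDual ℝ (Lp ℝ 2 μ)) R := fun n => by
    simp only [mem_preimage, Metric.mem_closedBall, dist_zero_right]
    change ‖InnerProductSpace.toDual ℝ (Lp ℝ 2 μ) (f n)‖ ≤ R
    rw [LinearIsometryEquiv.norm_map]; exact hR n
  obtain ⟨ψ, -, hψ⟩ := (WeakDual.isCompact_closedBall (𝕜 := ℝ)
    (0 : StrongDual ℝ (Lp ℝ 2 μ)) R).ultrafilter_le_nhds (U.map φ)
    (by rw [le_principal_iff]; exact (Filter.Eventually.of_forall hφ : ∀ᶠ n in (U : Filter ℕ), _))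
  let k : Lp ℝ 2 μ := (InnerProductSpace.toDual ℝ (Lp ℝ 2 μ)).symm (WeakDual.toStrongDual ψ)
  have hlim : SetTendsto U μ h k := by
    intro A hA
    have h1 := ((WeakDual.eval_continuous (𝕜 := ℝ)
      (indicatorConstLp 2 hA (measure_ne_top μ A) (1 : ℝ))).tendsto ψ).comp
      (show Tendsto φ U (𝓝 ψ) from hψ)
    have e1 : ∀ u : Lp ℝ 2 μ, inner ℝ u (indicatorConstLp 2 hA (measure_ne_top μ A) (1 : ℝ))
        = ∫ x in A, u x ∂μ := fun u => by
      rw [real_inner_comm, L2.inner_indicatorConstLp_one]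
    have e2 : ψ (indicatorConstLp 2 hA (measure_ne_top μ A) (1 : ℝ)) = ∫ x in A, k x ∂μ := by
      rw [← e1, InnerProductSpace.toDual_symm_apply]; rfl
    rw [e2] at h1
    refine h1.congr fun n => ?_
    change inner ℝ (f n) _ = _
    rw [e1]
    exact setIntegral_congr_ae hA ((hLp n).coeFn_toLp.mono fun x hx _ => hx)
  have hki : Integrable k μ := (Lp.memLp k).integrable (by norm_num)
  refine ⟨(Lp.aestronglyMeasurable k).mk k, (Lp.aestronglyMeasurable k).measurable_mk, ?_,
    hlim.congr_limit (Lp.aestronglyMeasurable k).ae_eq_mk⟩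
  have hpos : 0 ≤ᵐ[μ] (k : Ω → ℝ) := ae_nonneg_of_forall_setIntegral_nonneg hki fun A hA _ =>
    ge_of_tendsto' (hlim A hA) fun n =>
      setIntegral_nonneg_of_ae_restrict (ae_restrict_of_ae ((h0 n).mono fun x hx => hx.1))
  have hle : (k : Ω → ℝ) ≤ᵐ[μ] fun _ => B :=
    ae_le_of_forall_setIntegral_le hki (integrable_const B) fun A hA _ =>
      le_of_tendsto' (hlim A hA) fun n =>
        integral_mono_ae (integrable_of_ae_mem_Icc (hm n) (h0 n)).integrableOn
          (integrable_const B).integrableOn (ae_restrict_of_ae ((h0 n).mono fun x hx => hx.2))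
  filter_upwards [hpos, hle, (Lp.aestronglyMeasurable k).ae_eq_mk] with x h1 h2 h3
  rw [← h3]; exact ⟨h1, h2⟩

lemma tendsto_setIntegral_zero [IsFiniteMeasure μ] {h : ℕ → Ω → ℝ} {B : ℝ}
    (hm : ∀ n, AEStronglyMeasurable (h n) μ) (h0 : ∀ n, ∀ᵐ x ∂μ, 0 ≤ h n x ∧ h n x ≤ B)
    {A : Set Ω} (hA : MeasurableSet A) (hz : ∀ᵐ x ∂μ, x ∈ A → ∀ᶠ n in atTop, h n x = 0) :
    Tendsto (fun n => ∫ x in A, h n x ∂μ) atTop (𝓝 0) := by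
  have := tendsto_integral_of_dominated_convergence (μ := μ.restrict A) (F := h)
    (f := fun _ => (0 : ℝ)) (fun _ => B) (fun n => (hm n).restrict) (integrable_const B)
    (fun n => ae_restrict_of_ae ((h0 n).mono fun x hx => by
      rw [Real.norm_of_nonneg hx.1]; exact hx.2))
    ((ae_restrict_iff' hA).2 (hz.mono fun x hx hxA =>
      tendsto_const_nhds.congr' ((hx hxA).mono fun n hn => hn.symm)))
  simpa using this

/-- Where a setwise limit of nonnegative densities does not vanish, infinitely many of the
densities do not vanish: on the set where they vanish eventually, dominated convergence gives the
limit the integral zero. -/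
theorem SetTendsto.ae_frequently_ne_zero [IsFiniteMeasure μ] {U : Ultrafilter ℕ}
    (hU : (U : Filter ℕ) ≤ atTop) {h : ℕ → Ω → ℝ} {k : Ω → ℝ} {B : ℝ}
    (hm : ∀ n, AEStronglyMeasurable (h n) μ)
    (h0 : ∀ n, ∀ᵐ x ∂μ, 0 ≤ h n x ∧ h n x ≤ B) (hk : ∀ᵐ x ∂μ, 0 ≤ k x) (hki : Integrable k μ)
    (hlim : SetTendsto U μ h k) : ∀ᵐ x ∂μ, k x ≠ 0 → ∃ᶠ n in atTop, h n x ≠ 0 := by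
  let h' : ℕ → Ω → ℝ := fun n => (hm n).mk (h n)
  have hh : ∀ᵐ x ∂μ, ∀ n, h n x = h' n x := ae_all_iff.2 fun n => (hm n).ae_eq_mk
  let A : Set Ω := {x | ∀ᶠ n in atTop, h' n x = 0}
  have hA : MeasurableSet A := by
    simp only [A, eventually_atTop]
    have : {x | ∃ a, ∀ b ≥ a, h' b x = 0} = ⋃ a, ⋂ b ≥ a, {x | h' b x = 0} := by
      ext x; simp
    rw [this]
    exact MeasurableSet.iUnion fun a => MeasurableSet.iInter fun b => MeasurableSet.iInter fun _ =>
      (hm b).measurable_mk (measurableSet_singleton 0)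
  have h1 : Tendsto (fun n => ∫ x in A, h n x ∂μ) U (𝓝 0) :=
    (tendsto_setIntegral_zero hm h0 hA (hh.mono fun x hx hxA =>
      (show ∀ᶠ n in atTop, h' n x = 0 from hxA).mono fun n hn => by rw [hx n, hn])).mono_left hU
  have h2 := tendsto_nhds_unique (hlim A hA) h1
  rw [setIntegral_eq_zero_iff_of_nonneg_ae (ae_restrict_of_ae hk) hki.integrableOn,
    EventuallyEq, ae_restrict_iff' hA] at h2
  filter_upwards [h2, hh] with x hx hxh hne
  rw [Filter.Frequently]
  intro hev
  exact hne (hx (hev.mono fun n hn => by rw [← hxh n]; exact not_not.1 hn))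

/-- Limits of splittings: if the densities `f n` converge setwise to `f` and are split into
fractions `lam n`, then, for suitable limit fractions `lam₀`, the parts `lam n i * f n` converge
setwise to `lam₀ i * f`, and the limit makes almost everywhere only choices that are made for
infinitely many `n`. Where `f` vanishes the parts do not determine the limit fractions, and the
setwise limits of the fractions themselves are used. -/
theorem exists_split_limit [IsFiniteMeasure μ] {U : Ultrafilter ℕ}
    (hU : (U : Filter ℕ) ≤ atTop) {N : ℕ} {lam : ℕ → Fin N → Ω → ℝ}
    (hlm : ∀ n i, Measurable (lam n i))
    (hl : ∀ n, ∀ᵐ x ∂μ, (∀ i, 0 ≤ lam n i x) ∧ ∑ i, lam n i x = 1)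
    {f : ℕ → Ω → ℝ} {f₀ : Ω → ℝ} {B : ℝ} (hfm : ∀ n, AEStronglyMeasurable (f n) μ)
    (hf0 : ∀ n, ∀ᵐ x ∂μ, 0 ≤ f n x ∧ f n x ≤ B) (hf₀ : Integrable f₀ μ)
    (hlim : SetTendsto U μ f f₀) :
    ∃ lam₀ : Fin N → Ω → ℝ, (∀ i, Measurable (lam₀ i)) ∧
      (∀ᵐ x ∂μ, (∀ i, 0 ≤ lam₀ i x) ∧ ∑ i, lam₀ i x = 1) ∧
      (∀ i, SetTendsto U μ (fun n x => lam n i x * f n x) (fun x => lam₀ i x * f₀ x)) ∧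
      ∀ᵐ x ∂μ, ∀ i, lam₀ i x ≠ 0 → ∃ᶠ n in atTop, lam n i x ≠ 0 := by
  have hle1 : ∀ n, ∀ᵐ x ∂μ, ∀ i, 0 ≤ lam n i x ∧ lam n i x ≤ 1 := fun n =>
    (hl n).mono fun x hx i => ⟨hx.1 i, hx.2 ▸
      Finset.single_le_sum (fun j _ => hx.1 j) (Finset.mem_univ i)⟩
  have hpm : ∀ i n, AEStronglyMeasurable (fun x => lam n i x * f n x) μ := fun i n =>
    (hlm n i).aestronglyMeasurable.mul (hfm n)
  have hp0 : ∀ i n, ∀ᵐ x ∂μ, 0 ≤ lam n i x * f n x ∧ lam n i x * f n x ≤ B := fun i n => by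
    filter_upwards [hle1 n, hf0 n] with x h1 h2
    exact ⟨mul_nonneg (h1 i).1 h2.1, (mul_le_of_le_one_left h2.1 (h1 i).2).trans h2.2⟩
  have hlm' : ∀ i n, AEStronglyMeasurable (lam n i) μ := fun i n => (hlm n i).aestronglyMeasurable
  have hl0 : ∀ i n, ∀ᵐ x ∂μ, 0 ≤ lam n i x ∧ lam n i x ≤ 1 := fun i n =>
    (hle1 n).mono fun x hx => hx i
  choose p hpmeas hpB hplim using fun i => exists_setTendsto U (hpm i) (hp0 i)
  choose q hqmeas hqB hqlim using fun i => exists_setTendsto U (hlm' i) (hl0 i)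
  have hpi : ∀ i, Integrable (p i) μ := fun i =>
    integrable_of_ae_mem_Icc (hpmeas i).aestronglyMeasurable (hpB i)
  have hqi : ∀ i, Integrable (q i) μ := fun i =>
    integrable_of_ae_mem_Icc (hqmeas i).aestronglyMeasurable (hqB i)
  have hpsum : (fun x => ∑ i, p i x) =ᵐ[μ] f₀ := by
    refine Integrable.ae_eq_of_forall_setIntegral_eq _ _
      (integrable_finsetSum _ fun i _ => hpi i) hf₀ fun A hA _ => ?_
    rw [integral_finsetSum _ fun i _ => (hpi i).integrableOn]
    refine tendsto_nhds_unique (tendsto_finsetSum _ fun i _ => hplim i A hA)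
      ((hlim A hA).congr fun n => ?_)
    rw [← integral_finsetSum _ fun i _ =>
      (integrable_of_ae_mem_Icc (hpm i n) (hp0 i n)).integrableOn]
    refine setIntegral_congr_ae hA ((hl n).mono fun x hx _ => ?_)
    rw [← Finset.sum_mul, hx.2, one_mul]
  have hqsum : (fun x => ∑ i, q i x) =ᵐ[μ] fun _ => 1 := by
    refine Integrable.ae_eq_of_forall_setIntegral_eq _ _
      (integrable_finsetSum _ fun i _ => hqi i) (integrable_const 1) fun A hA _ => ?_
    rw [integral_finsetSum _ fun i _ => (hqi i).integrableOn]
    refine tendsto_nhds_unique (tendsto_finsetSum _ fun i _ => hqlim i A hA)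
      (tendsto_const_nhds.congr fun n => ?_)
    rw [← integral_finsetSum _ fun i _ =>
      (integrable_of_ae_mem_Icc (hlm' i n) (hl0 i n)).integrableOn]
    exact setIntegral_congr_ae hA ((hl n).mono fun x hx _ => hx.2.symm)
  have hpfreq : ∀ᵐ x ∂μ, ∀ i, p i x ≠ 0 → ∃ᶠ n in atTop, lam n i x * f n x ≠ 0 :=
    ae_all_iff.2 fun i => (hplim i).ae_frequently_ne_zero hU (hpm i) (hp0 i)
      ((hpB i).mono fun x hx => hx.1) (hpi i)
  have hqfreq : ∀ᵐ x ∂μ, ∀ i, q i x ≠ 0 → ∃ᶠ n in atTop, lam n i x ≠ 0 :=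
    ae_all_iff.2 fun i => (hqlim i).ae_frequently_ne_zero hU (hlm' i) (hl0 i)
      ((hqB i).mono fun x hx => hx.1) (hqi i)
  have hp0' : ∀ᵐ x ∂μ, ∀ i, 0 ≤ p i x := ae_all_iff.2 fun i => (hpB i).mono fun x hx => hx.1
  have hq0' : ∀ᵐ x ∂μ, ∀ i, 0 ≤ q i x := ae_all_iff.2 fun i => (hqB i).mono fun x hx => hx.1
  let S : Ω → ℝ := fun x => ∑ i, p i x
  have hS : Measurable S := Finset.measurable_fun_sum _ fun i _ => hpmeas i
  refine ⟨fun i x => if S x = 0 then q i x else p i x / S x, fun i =>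
    Measurable.ite (hS (measurableSet_singleton 0)) (hqmeas i) ((hpmeas i).div hS), ?_,
    fun i => (hplim i).congr_limit ?_, ?_⟩
  · filter_upwards [hqsum, hp0', hq0'] with x h1 h2 h3
    by_cases hx : S x = 0
    · simp only [hx, if_true]; exact ⟨h3, h1⟩
    · simp only [hx, if_false]
      refine ⟨fun i => div_nonneg (h2 i) (Finset.sum_nonneg fun i _ => h2 i), ?_⟩
      rw [← Finset.sum_div]; exact div_self hx
  · filter_upwards [hpsum, hp0'] with x h1 h2
    by_cases hx : S x = 0
    · rw [(Finset.sum_eq_zero_iff_of_nonneg fun i _ => h2 i).1 hx i (Finset.mem_univ i), ← h1]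
      simp only [S] at hx
      rw [hx, mul_zero]
    · simp only [hx, if_false]
      rw [← h1]; exact (div_mul_cancel₀ _ hx).symm
  · filter_upwards [hpfreq, hqfreq] with x h1 h2 i
    by_cases hx : S x = 0
    · simp only [hx, if_true]; exact h2 i
    · simp only [hx, if_false]
      exact fun hne => (h1 i fun h => hne (by rw [h, zero_div])).mono fun n hn =>
        left_ne_zero_of_mul hn

end SetwiseConvergence

/-! ### Arrival flows -/

section ArrivalFlows

/-- By Lebesgue's differentiation theorem, a density whose integrals over intervals are at most
`B` times their length is at most `B`. -/
lemma ae_le_of_intervalIntegral_le {q : ℝ → ℝ} {T B : ℝ} (hT : 0 ≤ T)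
    (hq : IntegrableOn q (Icc 0 T))
    (h : ∀ s ∈ Icc 0 T, ∀ t ∈ Icc 0 T, s ≤ t → ∫ x in s..t, q x ≤ B * (t - s)) :
    ∀ᵐ t ∂(volume.restrict (Icc 0 T)), q t ≤ B := by
  have hqi : IntervalIntegrable q volume 0 T := by
    rw [intervalIntegrable_iff_integrableOn_Icc_of_le hT]; exact hq
  have h1 := hqi.ae_hasDerivAt_integral
  rw [restrict_Ioo_eq_restrict_Icc.symm, ae_restrict_iff' measurableSet_Ioo]
  filter_upwards [h1] with t ht htm
  have htI : t ∈ uIcc 0 T := by rw [uIcc_of_le hT]; exact Ioo_subset_Icc_self htm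
  have hd := ht htI 0 left_mem_uIcc
  have hd' := (hasDerivAt_iff_tendsto_slope.1 hd).mono_left
    (nhdsWithin_mono t (show Ioi t ⊆ {t}ᶜ from fun x hx => ne_of_gt hx))
  refine le_of_tendsto hd' ?_
  filter_upwards [Ioo_mem_nhdsGT htm.2] with x hx
  have hx0 : x ∈ Icc 0 T := ⟨htm.1.le.trans hx.1.le, hx.2.le⟩
  have ht0 : t ∈ Icc 0 T := Ioo_subset_Icc_self htm
  rw [slope_def_field, div_le_iff₀ (sub_pos.2 hx.1), intervalIntegral.integral_interval_sub_left]
  · exact h t ht0 x hx0 hx.1.le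
  · exact hqi.mono_set (uIcc_subset_uIcc left_mem_uIcc (by rw [uIcc_of_le hT]; exact hx0))
  · exact hqi.mono_set (uIcc_subset_uIcc left_mem_uIcc htI)

/-- If the densities `h n` live on sets `A n` that are eventually contained, pointwise, in `C n`,
then up to a vanishing error `A n` carries no more mass than `C n`. -/
lemma exists_tendsto_setIntegral_le {Ω : Type*} [MeasurableSpace Ω] {μ : Measure Ω}
    [IsFiniteMeasure μ] {h : ℕ → Ω → ℝ} {B : ℝ}
    (hm : ∀ n, AEStronglyMeasurable (h n) μ) (h0 : ∀ n, ∀ᵐ x ∂μ, 0 ≤ h n x ∧ h n x ≤ B)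
    {A C : ℕ → Set Ω} (hA : ∀ n, MeasurableSet (A n)) (hC : ∀ n, MeasurableSet (C n))
    (hAC : ∀ᵐ x ∂μ, ∀ᶠ n in atTop, h n x ≠ 0 → x ∈ A n → x ∈ C n) :
    ∃ r : ℕ → ℝ, Tendsto r atTop (𝓝 0) ∧
      ∀ n, ∫ x in A n, h n x ∂μ ≤ ∫ x in C n, h n x ∂μ + r n := by
  have hD : ∀ n, MeasurableSet (A n \ C n) := fun n => (hA n).diff (hC n)
  refine ⟨fun n => ∫ x, (A n \ C n).indicator (h n) x ∂μ, ?_, fun n => ?_⟩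
  · have hz : ∀ᵐ x ∂μ, x ∈ univ → ∀ᶠ n in atTop, (A n \ C n).indicator (h n) x = 0 := by
      filter_upwards [hAC] with x hx _
      filter_upwards [hx] with n hn
      by_contra hne
      rw [indicator_apply_eq_zero] at hne
      push Not at hne
      exact hne.1.2 (hn hne.2 hne.1.1)
    have := tendsto_setIntegral_zero (B := B) (fun n => (hm n).indicator (hD n)) (fun n => by
      filter_upwards [h0 n] with x hx
      by_cases hxD : x ∈ A n \ C n
      · rw [indicator_of_mem hxD]; exact hx
      · rw [indicator_of_notMem hxD]; exact ⟨le_rfl, hx.1.trans hx.2⟩) MeasurableSet.univ hz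
    simpa using this
  · have hi := integrable_of_ae_mem_Icc (hm n) (h0 n)
    beta_reduce
    rw [integral_indicator (hD n), ← integral_inter_add_sdiff (hC n) hi.integrableOn]
    gcongr ?_ + _
    exact setIntegral_mono_set hi.integrableOn
      (ae_restrict_of_ae ((h0 n).mono fun x hx => hx.1)) inter_subset_right.eventuallyLE

lemma setIntegral_Ioc_restrict {q : ℝ → ℝ} {T t : ℝ} (ht : t ∈ Icc 0 T) :
    ∫ x in Ioc 0 t, q x ∂(volume.restrict (Icc 0 T)) = ∫ x in (0 : ℝ)..t, q x := by
  rw [Measure.restrict_restrict measurableSet_Ioc, intervalIntegral.integral_of_le ht.1,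
    inter_eq_left.2 (Ioc_subset_Icc_self.trans (Icc_subset_Icc_right ht.2))]

lemma SetTendsto.intervalIntegral {l : Filter ℕ} {T : ℝ} {q : ℕ → ℝ → ℝ} {q₀ : ℝ → ℝ}
    (hq : SetTendsto l (volume.restrict (Icc 0 T)) q q₀) {t : ℝ} (ht : t ∈ Icc 0 T) :
    Tendsto (fun n => ∫ x in (0 : ℝ)..t, q n x) l (𝓝 (∫ x in (0 : ℝ)..t, q₀ x)) := by
  have := hq (Ioc 0 t) measurableSet_Ioc
  simp only [setIntegral_Ioc_restrict ht] at this
  exact this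

/-- The relation between departure densities, arrival times and arrival flows is closed under
setwise convergence of the densities and almost everywhere convergence of the arrival times that
are used. The mass arrived by the time `t` in the limit lies between the limits of the masses
arrived by slightly earlier and slightly later times, and these agree because the limit flow is a
density. -/
theorem isArrivalFlow_of_setTendsto (M : Model) {U : Ultrafilter ℕ}
    (hU : (U : Filter ℕ) ≤ atTop) {h : ℕ → ℝ → ℝ} {h₀ : ℝ → ℝ} {B : ℝ}
    (hm : ∀ n, AEStronglyMeasurable (h n) (volume.restrict (Icc 0 M.T)))
    (h0 : ∀ n, ∀ᵐ x ∂(volume.restrict (Icc 0 M.T)), 0 ≤ h n x ∧ h n x ≤ B)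
    (hlim : SetTendsto U (volume.restrict (Icc 0 M.T)) h h₀)
    {τ : ℕ → ℝ → ℝ} {τ₀ : ℝ → ℝ} (hτm : ∀ n, Measurable (τ n)) (hτ₀m : Measurable τ₀)
    (hτ : ∀ᵐ x ∂(volume.restrict (Icc 0 M.T)), ∀ ε > 0, ∀ᶠ n in atTop,
      h n x ≠ 0 → |τ n x - τ₀ x| < ε)
    {q : ℕ → ℝ → ℝ} {q₀ : ℝ → ℝ} (hq : ∀ n, M.IsArrivalFlow (h n) (τ n) (q n))
    (hq₀ : IntegrableOn q₀ (Icc 0 M.T))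
    (hq₀0 : ∀ᵐ x ∂(volume.restrict (Icc 0 M.T)), 0 ≤ q₀ x)
    (hqlim : SetTendsto U (volume.restrict (Icc 0 M.T)) q q₀) :
    M.IsArrivalFlow h₀ τ₀ q₀ := by
  have hT := M.T_pos.le
  refine ⟨hq₀, by rw [restrict_Ioo_eq_restrict_Icc]; exact hq₀0, fun t ht => ?_⟩
  have hmeas : ∀ {σ : ℝ → ℝ} (t : ℝ), Measurable σ → MeasurableSet {s | σ s ≤ t} :=
    fun t hσ => hσ measurableSet_Iic
  have hres : ∀ {σ : ℝ → ℝ} (t : ℝ) (f : ℝ → ℝ), Measurable σ →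
      ∫ s in Icc 0 M.T ∩ {s | σ s ≤ t}, f s
        = ∫ s in {s | σ s ≤ t}, f s ∂(volume.restrict (Icc 0 M.T)) := fun t f hσ => by
    rw [Measure.restrict_restrict (hmeas t hσ), inter_comm]
  have hG : ContinuousOn (fun x => ∫ s in (0 : ℝ)..x, q₀ s) (Icc 0 M.T) := by
    have := intervalIntegral.continuousOn_primitive_interval (μ := volume) (f := q₀) (a := 0)
      (b := M.T) (by rw [uIcc_of_le hT]; exact hq₀)
    rwa [uIcc_of_le hT] at this
  have htI : t ∈ Icc 0 M.T := Ico_subset_Icc_self ht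
  have hA := hlim _ (hmeas t hτ₀m)
  rw [hres t _ hτ₀m]
  refine le_antisymm ?_ ?_
  · rcases eq_or_lt_of_le ht.1 with h0t | h0t
    · rw [← h0t, intervalIntegral.integral_same]
      have hA' := hlim _ (hmeas 0 hτ₀m)
      exact ge_of_tendsto' hA' fun n => setIntegral_nonneg_of_ae_restrict
        (ae_restrict_of_ae ((h0 n).mono fun x hx => hx.1))
    have hle : ∀ t' ∈ Ioo 0 t, ∫ s in (0 : ℝ)..t', q₀ s
        ≤ ∫ s in {s | τ₀ s ≤ t}, h₀ s ∂(volume.restrict (Icc 0 M.T)) := by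
      intro t' ht'
      have ht'I : t' ∈ Icc 0 M.T := ⟨ht'.1.le, ht'.2.le.trans htI.2⟩
      obtain ⟨r, hr, hr'⟩ := exists_tendsto_setIntegral_le hm h0
        (A := fun n => {s | τ n s ≤ t'}) (C := fun n => {s | τ₀ s ≤ t})
        (fun n => hmeas t' (hτm n)) (fun n => hmeas t hτ₀m) (by
          filter_upwards [hτ] with x hx
          filter_upwards [hx (t - t') (sub_pos.2 ht'.2)] with n hn hne hxA
          have := abs_lt.1 (hn hne)
          change _ ≤ _ at hxA
          change _ ≤ _
          linarith)
      have h1 := hA.add (hr.mono_left hU)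
      rw [add_zero] at h1
      refine le_of_tendsto_of_tendsto' (hqlim.intervalIntegral ht'I) h1 fun n => ?_
      rw [(hq n).2.2 t' ⟨ht'I.1, ht'.2.trans ht.2⟩, hres t' _ (hτm n)]
      exact hr' n
    have hc : Tendsto (fun x => ∫ s in (0 : ℝ)..x, q₀ s) (𝓝[Ioo 0 t] t)
        (𝓝 (∫ s in (0 : ℝ)..t, q₀ s)) :=
      (hG t htI).mono_left (nhdsWithin_mono t fun x hx => ⟨hx.1.le, hx.2.le.trans htI.2⟩)
    have : (𝓝[Ioo 0 t] t).NeBot := right_nhdsWithin_Ioo_neBot h0t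
    exact le_of_tendsto hc (eventually_mem_nhdsWithin.mono hle)
  · have hle : ∀ t' ∈ Ioo t M.T, ∫ s in {s | τ₀ s ≤ t}, h₀ s ∂(volume.restrict (Icc 0 M.T))
        ≤ ∫ s in (0 : ℝ)..t', q₀ s := by
      intro t' ht'
      have ht'I : t' ∈ Icc 0 M.T := ⟨htI.1.trans ht'.1.le, ht'.2.le⟩
      obtain ⟨r, hr, hr'⟩ := exists_tendsto_setIntegral_le hm h0
        (A := fun n => {s | τ₀ s ≤ t}) (C := fun n => {s | τ n s ≤ t'})
        (fun n => hmeas t hτ₀m) (fun n => hmeas t' (hτm n)) (by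
          filter_upwards [hτ] with x hx
          filter_upwards [hx (t' - t) (sub_pos.2 ht'.1)] with n hn hne hxA
          have := abs_lt.1 (hn hne)
          change _ ≤ _ at hxA
          change _ ≤ _
          linarith)
      have h1 := (hqlim.intervalIntegral ht'I).add (hr.mono_left hU)
      rw [add_zero] at h1
      refine le_of_tendsto_of_tendsto' hA h1 fun n => ?_
      rw [(hq n).2.2 t' ⟨ht'I.1, ht'.2⟩, hres t' _ (hτm n)]
      exact hr' n
    have hc : Tendsto (fun x => ∫ s in (0 : ℝ)..x, q₀ s) (𝓝[Ioo t M.T] t)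
        (𝓝 (∫ s in (0 : ℝ)..t, q₀ s)) :=
      (hG t htI).mono_left (nhdsWithin_mono t fun x hx => ⟨htI.1.trans hx.1.le, hx.2.le⟩)
    have : (𝓝[Ioo t M.T] t).NeBot := left_nhdsWithin_Ioo_neBot ht.2
    exact ge_of_tendsto hc (eventually_mem_nhdsWithin.mono hle)

end ArrivalFlows

/-! ### Uniformly close extended-real functions -/

section Near

/-- Two extended reals that differ by at most the real number `e`. -/
def Near (e : ℝ) (a b : EReal) : Prop := a ≤ b + (e : EReal) ∧ b ≤ a + (e : EReal)

lemma near_coe {e x y : ℝ} (h : |x - y| ≤ e) : Near e x y := by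
  have := abs_le.1 h
  constructor <;> (norm_cast; linarith)

lemma near_zero_refl (a : EReal) : Near 0 a a := by simp [Near]

lemma Near.add {e e' : ℝ} {a b a' b' : EReal} (h : Near e a b) (h' : Near e' a' b') :
    Near (e + e') (a + a') (b + b') := by
  constructor
  · rw [EReal.coe_add, add_add_add_comm]; exact add_le_add h.1 h'.1
  · rw [EReal.coe_add, add_add_add_comm]; exact add_le_add h.2 h'.2

lemma Near.mono {e e' : ℝ} {a b : EReal} (h : Near e a b) (hee' : e ≤ e') : Near e' a b :=
  ⟨h.1.trans (by gcongr), h.2.trans (by gcongr)⟩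

lemma Near.const_add {e : ℝ} {a b : EReal} (c : EReal) (h : Near e a b) :
    Near e (c + a) (c + b) := by
  simpa using (near_zero_refl c).add h

lemma Near.min {e : ℝ} {a b a' b' : EReal} (h : Near e a b) (h' : Near e a' b') :
    Near e (min a a') (min b b') := by
  constructor
  · rw [← min_add_add_right]; exact min_le_min h.1 h'.1
  · rw [← min_add_add_right]; exact min_le_min h.2 h'.2

lemma Near.iInf {e : ℝ} {S : Set ℝ} {f g : ℝ → EReal} (h : ∀ x ∈ S, Near e (f x) (g x)) :
    Near e (⨅ x ∈ S, f x) (⨅ x ∈ S, g x) := by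
  have aux : ∀ {f g : ℝ → EReal}, (∀ x ∈ S, f x ≤ g x + (e : EReal)) →
      (⨅ x ∈ S, f x) ≤ (⨅ x ∈ S, g x) + (e : EReal) := by
    intro f g h
    rw [← EReal.sub_le_iff_le_add (Or.inl (EReal.coe_ne_bot e)) (Or.inl (EReal.coe_ne_top e))]
    refine le_iInf₂ fun x hx => ?_
    rw [EReal.sub_le_iff_le_add (Or.inl (EReal.coe_ne_bot e)) (Or.inl (EReal.coe_ne_top e))]
    exact (iInf₂_le x hx).trans (h x hx)
  exact ⟨aux fun x hx => (h x hx).1, aux fun x hx => (h x hx).2⟩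

lemma le_of_frequently_le_add {e : ℕ → ℝ} (he : Tendsto e atTop (𝓝 0)) {a b : EReal}
    (h : ∃ᶠ n in atTop, a ≤ b + (e n : EReal)) : a ≤ b := by
  by_contra! hlt
  obtain ⟨r, hbr, hra⟩ := EReal.lt_iff_exists_real_btwn.1 hlt
  obtain ⟨r', hrr', hr'a⟩ := EReal.lt_iff_exists_real_btwn.1 hra
  have hrr : r < r' := by exact_mod_cast hrr'
  refine h ?_
  filter_upwards [he.eventually (gt_mem_nhds (sub_pos.2 hrr))] with n hn
  rw [not_le]
  calc b + (e n : EReal) ≤ (r : EReal) + ((r' - r : ℝ) : EReal) := by gcongr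
    _ = (r' : EReal) := by norm_cast; ring
    _ < a := hr'a

lemma eq_of_frequently_eq {e : ℕ → ℝ} (he : Tendsto e atTop (𝓝 0)) {a b : EReal}
    {a' b' : ℕ → EReal} (ha : ∀ n, Near (e n) (a' n) a) (hb : ∀ n, Near (e n) (b' n) b)
    (h : ∃ᶠ n in atTop, a' n = b' n) : a = b := by
  have he2 : Tendsto (fun n => e n + e n) atTop (𝓝 0) := by simpa using he.add he
  refine le_antisymm (le_of_frequently_le_add he2 (h.mono fun n hn => ?_))
    (le_of_frequently_le_add he2 (h.mono fun n hn => ?_))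
  · rw [EReal.coe_add, ← add_assoc]
    exact (ha n).2.trans (by rw [hn]; gcongr; exact (hb n).1)
  · rw [EReal.coe_add, ← add_assoc]
    exact (hb n).2.trans (by rw [← hn]; gcongr; exact (ha n).1)

/-- Stability of a unique minimizer: minimizers of uniformly close functions on a compact set are
close to the unique minimizer of a continuous function. -/
lemma eventually_abs_sub_argmin_lt {K : Set ℝ} (hK : IsCompact K) {c : ℝ → EReal}
    {c' : ℕ → ℝ → EReal} (hc : ContinuousOn c K) {e : ℕ → ℝ} (he : Tendsto e atTop (𝓝 0))
    (hcc' : ∀ n, ∀ x ∈ K, Near (e n) (c' n x) (c x)) {x₀ : ℝ} (hx₀ : x₀ ∈ K)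
    (hmin : ∀ x ∈ K, c x₀ ≤ c x)
    (huniq : ∀ x ∈ K, (∀ y ∈ K, c x ≤ c y) → x = x₀) {ε : ℝ} (hε : 0 < ε) :
    ∀ᶠ n in atTop, ∀ x ∈ K, (∀ y ∈ K, c' n x ≤ c' n y) → |x - x₀| < ε := by
  have he2 : Tendsto (fun n => e n + e n) atTop (𝓝 0) := by simpa using he.add he
  let K' : Set ℝ := K ∩ {x | ε ≤ |x - x₀|}
  have hK' : IsCompact K' := hK.inter_right (isClosed_le continuous_const (by fun_prop))
  by_contra hcon
  have hfr : ∃ᶠ n in atTop, ∃ x ∈ K', ∀ y ∈ K, c' n x ≤ c' n y := by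
    refine (not_eventually.1 hcon).mono fun n hn => ?_
    push Not at hn
    obtain ⟨x, hx, h1, h2⟩ := hn
    exact ⟨x, ⟨hx, h2⟩, h1⟩
  obtain ⟨-, x₁, hx₁, -⟩ := hfr.exists
  obtain ⟨z, hz, hzmin⟩ := hK'.exists_isMinOn ⟨x₁, hx₁⟩ (hc.mono inter_subset_left)
  have hzle : c z ≤ c x₀ := by
    refine le_of_frequently_le_add he2 (hfr.mono ?_)
    rintro n ⟨x, hx, hxmin⟩
    calc c z ≤ c x := hzmin hx
      _ ≤ c' n x + (e n : EReal) := (hcc' n x hx.1).2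
      _ ≤ c x₀ + (e n : EReal) + (e n : EReal) := by
          gcongr; exact (hxmin x₀ hx₀).trans (hcc' n x₀ hx₀).1
      _ = c x₀ + ((e n + e n : ℝ) : EReal) := by rw [EReal.coe_add, add_assoc]
  have := huniq z hz.1 fun y hy => hzle.trans (hmin y hy)
  have h2 : ε ≤ |z - x₀| := hz.2
  rw [this, sub_self, abs_zero] at h2
  exact absurd h2 (not_le.2 hε)

end Near

/-! ### Dependence of the costs on the congestion -/

section Costs

lemma moveCost_nonneg (d h : ℝ) : 0 ≤ moveCost d h := by
  unfold moveCost
  split_ifs with hh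
  · exact_mod_cast div_nonneg (sq_nonneg d) (by positivity)
  · exact le_top

lemma moveCost_ne_bot (d h : ℝ) : moveCost d h ≠ ⊥ :=
  ((EReal.bot_lt_zero).trans_le (moveCost_nonneg d h)).ne'

lemma moveCost_of_pos {d h : ℝ} (hh : 0 < h) : moveCost d h = ((d ^ 2 / (2 * h) : ℝ) : EReal) :=
  if_pos hh

lemma moveCost_of_nonpos {d h : ℝ} (hh : h ≤ 0) : moveCost d h = ⊤ := if_neg hh.not_gt

lemma continuous_moveCost {d : ℝ} (hd : d ≠ 0) : Continuous (moveCost d) := by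
  have hc : 0 < d ^ 2 / 2 := by positivity
  -- the quotient in `ℝ≥0∞` is continuous and takes the value `⊤` for the durations `h ≤ 0`
  have : moveCost d = fun h => ((ENNReal.ofReal (d ^ 2 / 2) * (ENNReal.ofReal h)⁻¹ : ℝ≥0∞) :
      EReal) := by
    funext h
    rcases le_or_gt h 0 with hh | hh
    · rw [moveCost_of_nonpos hh, ENNReal.ofReal_of_nonpos hh, ENNReal.inv_zero,
        ENNReal.mul_top (by simpa using hc), EReal.coe_ennreal_top]
    · rw [moveCost_of_pos hh, ← ENNReal.ofReal_inv_of_pos hh, ← ENNReal.ofReal_mul hc.le,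
        EReal.coe_ennreal_ofReal, max_eq_left (by positivity)]
      congr 1
      field_simp
  rw [this]
  exact continuous_coe_ennreal_ereal.comp
    ((ENNReal.continuous_const_mul ENNReal.ofReal_ne_top).comp
      (continuous_inv.comp ENNReal.continuous_ofReal))

lemma _root_.ContinuousOn.ereal_add {X : Type*} [TopologicalSpace X] {S : Set X} {f g : X → EReal}
    (hf : ContinuousOn f S) (hg : ContinuousOn g S) (hf' : ∀ x ∈ S, f x ≠ ⊥)
    (hg' : ∀ x ∈ S, g x ≠ ⊥) : ContinuousOn (fun x => f x + g x) S := fun x hx =>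
  Tendsto.comp (EReal.continuousAt_add (p := (f x, g x)) (Or.inr (hg' x hx)) (Or.inl (hf' x hx)))
    ((hf x hx).prodMk_nhds (hg x hx))

/-- The cost of reaching at the time `τ` a point at distance `d`, leaving at the time `t` on the
branch `w`, and of going on from there with the cost `V τ`. -/
noncomputable def visitCost (F : Label → ℝ → ℝ) (w : Label) (d : ℝ) (V : ℝ → EReal) (t τ : ℝ) :
    EReal :=
  moveCost d (τ - t) + ((∫ s in t..τ, F w s : ℝ) : EReal) + V τ

lemma visitCost_of_le (F : Label → ℝ → ℝ) (w : Label) (d : ℝ) {V : ℝ → EReal} {t τ : ℝ}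
    (hV : V τ ≠ ⊥) (h : τ ≤ t) : visitCost F w d V t τ = ⊤ := by
  rw [visitCost, moveCost_of_nonpos (sub_nonpos.2 h), EReal.top_add_coe, EReal.top_add_of_ne_bot hV]

lemma visitCost_ne_bot (F : Label → ℝ → ℝ) (w : Label) (d : ℝ) {V : ℝ → EReal} (t : ℝ) {τ : ℝ}
    (hV : V τ ≠ ⊥) : visitCost F w d V t τ ≠ ⊥ := by
  simp [visitCost, EReal.add_eq_bot_iff, moveCost_ne_bot, hV]

lemma continuousOn_visitCost {F : Label → ℝ → ℝ} (hF : ∀ w, Continuous (F w)) (w : Label) {d : ℝ}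
    (hd : d ≠ 0) {V : ℝ → EReal} {S : Set ℝ} (hV : ContinuousOn V S) (hV' : ∀ τ ∈ S, V τ ≠ ⊥) :
    ContinuousOn (fun p : ℝ × ℝ => visitCost F w d V p.1 p.2) (univ ×ˢ S) := by
  have h1 : Continuous fun p : ℝ × ℝ => moveCost d (p.2 - p.1) :=
    (continuous_moveCost hd).comp (by fun_prop)
  have h2 : Continuous fun p : ℝ × ℝ => ((∫ s in p.1..p.2, F w s : ℝ) : EReal) := by
    refine continuous_coe_real_ereal.comp ?_
    have hi : ∀ a b, IntervalIntegrable (F w) volume a b := fun a b => (hF w).intervalIntegrable a b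
    have : (fun p : ℝ × ℝ => ∫ s in p.1..p.2, F w s)
        = fun p => (∫ s in (0 : ℝ)..p.2, F w s) - ∫ s in (0 : ℝ)..p.1, F w s := by
      funext p; rw [intervalIntegral.integral_interval_sub_left (hi _ _) (hi _ _)]
    rw [this]
    have hc := intervalIntegral.continuous_primitive hi 0
    exact (hc.comp continuous_snd).sub (hc.comp continuous_fst)
  refine (h1.continuousOn.ereal_add h2.continuousOn (fun _ _ => moveCost_ne_bot _ _)
    (fun _ _ => EReal.coe_ne_bot _)).ereal_add (hV.comp continuousOn_snd fun p hp => hp.2) ?_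
    fun p hp => hV' _ hp.2
  intro p _
  simp [EReal.add_eq_bot_iff, moveCost_ne_bot]

lemma near_intervalIntegral {f f' : ℝ → ℝ} {T e : ℝ} (hf : ContinuousOn f (Icc 0 T))
    (hf' : ContinuousOn f' (Icc 0 T)) (he : ∀ s ∈ Icc 0 T, |f s - f' s| ≤ e) {t τ : ℝ}
    (ht : 0 ≤ t) (htτ : t ≤ τ) (hτ : τ ≤ T) :
    Near (e * T) ((∫ s in t..τ, f s : ℝ) : EReal) ((∫ s in t..τ, f' s : ℝ) : EReal) := by
  have hsub : Icc t τ ⊆ Icc 0 T := Icc_subset_Icc ht hτ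
  have h0 : 0 ≤ e := (abs_nonneg _).trans (he t ⟨ht, htτ.trans hτ⟩)
  refine near_coe ?_
  rw [← intervalIntegral.integral_sub
    ((hf.mono hsub).intervalIntegrable_of_Icc htτ) ((hf'.mono hsub).intervalIntegrable_of_Icc htτ)]
  have := intervalIntegral.norm_integral_le_of_norm_le_const (a := t) (b := τ)
    (f := fun s => f s - f' s) (C := e) fun s hs => by
      rw [uIoc_of_le htτ] at hs
      exact he s (hsub ⟨hs.1.le, hs.2⟩)
  refine this.trans (mul_le_mul_of_nonneg_left ?_ h0)
  rw [abs_of_nonneg (sub_nonneg.2 htτ)]; linarith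

namespace Model

variable (M : Model)

/-- The integrals of the two congestion costs over every subinterval of `[0, T]` differ by at most
`e`. -/
def NearCosts (e : ℝ) (F F' : Label → ℝ → ℝ) : Prop :=
  ∀ w t τ, 0 ≤ t → t ≤ τ → τ ≤ M.T →
    Near e ((∫ s in t..τ, F w s : ℝ) : EReal) ((∫ s in t..τ, F' w s : ℝ) : EReal)

variable {M} {e : ℝ} {F F' : Label → ℝ → ℝ}

lemma NearCosts.nonneg (h : M.NearCosts e F F') : 0 ≤ e := by
  have := (h (0, 0) 0 0 le_rfl le_rfl M.T_pos.le).1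
  simpa using this

lemma NearCosts.stay00 (h : M.NearCosts e F F') {t : ℝ} (ht : t ∈ Icc 0 M.T) :
    Near e (M.stay00 F t) (M.stay00 F' t) := by
  simp only [Model.stay00, EReal.coe_add]
  exact (h _ t M.T ht.1 ht.2 le_rfl).const_add _

lemma NearCosts.home00 (h : M.NearCosts e F F') (θ : AddCircle (2 * Real.pi)) {t : ℝ}
    (ht : t ∈ Icc 0 M.T) : Near e (M.home00 F θ t) (M.home00 F' θ t) :=
  (h _ t M.T ht.1 ht.2 le_rfl).const_add _

lemma NearCosts.V00 (h : M.NearCosts e F F') (θ : AddCircle (2 * Real.pi)) {t : ℝ}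
    (ht : t ∈ Icc 0 M.T) : Near e (M.V00 F θ t) (M.V00 F' θ t) :=
  (h.stay00 ht).min (h.home00 θ ht)

lemma NearCosts.visitCost {e' : ℝ} (h : M.NearCosts e F F') (w : Label) (d : ℝ) {V V' : ℝ → EReal}
    (hV : ∀ t ∈ Icc 0 M.T, Near e' (V t) (V' t)) {t τ : ℝ} (ht : t ∈ Icc 0 M.T)
    (hτ : τ ∈ Icc t M.T) :
    Near (e + e') (visitCost F w d V t τ) (visitCost F' w d V' t τ) :=
  ((h w t τ ht.1 hτ.1 hτ.2).const_add _).add (hV τ ⟨ht.1.trans hτ.1, hτ.2⟩)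

lemma NearCosts.stayOne (h : M.NearCosts e F F') (w : Label) (c : ℝ) {t : ℝ}
    (ht : t ∈ Icc 0 M.T) : Near e (M.stayOne F w c t) (M.stayOne F' w c t) := by
  simp only [Model.stayOne, EReal.coe_add]
  exact (h _ t M.T ht.1 ht.2 le_rfl).const_add _

lemma NearCosts.homeOne (h : M.NearCosts e F F') (w : Label) (c : ℝ) (θ : AddCircle (2 * Real.pi))
    {t : ℝ} (ht : t ∈ Icc 0 M.T) : Near e (M.homeOne F w c θ t) (M.homeOne F' w c θ t) :=
  (h _ t M.T ht.1 ht.2 le_rfl).const_add _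

lemma NearCosts.visitOne (h : M.NearCosts e F F') (w : Label) (θ θ' : AddCircle (2 * Real.pi))
    {t τ : ℝ} (ht : t ∈ Icc 0 M.T) (hτ : τ ∈ Icc t M.T) :
    Near (e + e) (M.visitOne F w θ θ' t τ) (M.visitOne F' w θ θ' t τ) :=
  h.visitCost w (dist θ θ') (fun _ ht => h.V00 θ' ht) ht hτ

lemma NearCosts.VOne (h : M.NearCosts e F F') (w : Label) (c : ℝ) (θ θ' : AddCircle (2 * Real.pi))
    {t : ℝ} (ht : t ∈ Icc 0 M.T) : Near (e + e) (M.VOne F w c θ θ' t) (M.VOne F' w c θ θ' t) :=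
  have he : e ≤ e + e := le_add_of_nonneg_left h.nonneg
  ((h.stayOne w c ht).mono he).min (((h.homeOne w c θ ht).mono he).min
    (Near.iInf fun _ hτ => h.visitOne w θ θ' ht hτ))

lemma NearCosts.stay11 (h : M.NearCosts e F F') {t : ℝ} (ht : t ∈ Icc 0 M.T) :
    Near e (M.stay11 F t) (M.stay11 F' t) := by
  simp only [Model.stay11, EReal.coe_add]
  exact (h _ t M.T ht.1 ht.2 le_rfl).const_add _

lemma NearCosts.visit11_1 (h : M.NearCosts e F F') {t τ : ℝ} (ht : t ∈ Icc 0 M.T)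
    (hτ : τ ∈ Icc t M.T) : Near (e + (e + e)) (M.visit11_1 F t τ) (M.visit11_1 F' t τ) :=
  h.visitCost (1, 1) (dist M.θS M.θ₁) (fun _ ht => h.VOne _ _ _ _ ht) ht hτ

lemma NearCosts.visit11_2 (h : M.NearCosts e F F') {t τ : ℝ} (ht : t ∈ Icc 0 M.T)
    (hτ : τ ∈ Icc t M.T) : Near (e + (e + e)) (M.visit11_2 F t τ) (M.visit11_2 F' t τ) :=
  h.visitCost (1, 1) (dist M.θS M.θ₂) (fun _ ht => h.VOne _ _ _ _ ht) ht hτ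

lemma NearCosts.V11 (h : M.NearCosts e F F') {t : ℝ} (ht : t ∈ Icc 0 M.T) :
    Near (e + (e + e)) (M.V11 F t) (M.V11 F' t) :=
  have he : e ≤ e + (e + e) := by linarith [h.nonneg]
  ((h.stay11 ht).mono he).min ((Near.iInf fun _ hτ => h.visit11_1 ht hτ).min
    (Near.iInf fun _ hτ => h.visit11_2 ht hτ))

end Model

end Costs

/-! ### Continuity of the value functions -/

section Values

namespace Model

variable {M : Model} {F : Label → ℝ → ℝ}

lemma continuous_integral_to {f : ℝ → ℝ} (hf : Continuous f) (T : ℝ) :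
    Continuous fun t => ∫ s in t..T, f s := by
  have hc := intervalIntegral.continuous_primitive (μ := volume)
    (fun a b => hf.intervalIntegrable a b) T
  have : (fun t => ∫ s in t..T, f s) = fun t => -∫ s in T..t, f s := by
    funext t; rw [intervalIntegral.integral_symm]
  rw [this]; exact hc.neg

lemma continuous_V00 (hF : ∀ w, Continuous (F w)) {θ : AddCircle (2 * Real.pi)}
    (hθ : θ ≠ M.θS) : Continuous (M.V00 F θ) := by
  have hi := continuous_integral_to (hF (0, 0)) M.T
  refine Continuous.min (continuous_coe_real_ereal.comp (continuous_const.add hi)) ?_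
  rw [← continuousOn_univ]
  refine ContinuousOn.ereal_add ?_ (continuous_coe_real_ereal.comp hi).continuousOn
    (fun _ _ => moveCost_ne_bot _ _) (fun _ _ => EReal.coe_ne_bot _)
  exact ((continuous_moveCost (dist_ne_zero.2 hθ)).comp
    (continuous_const.sub continuous_id)).continuousOn

lemma V00_ne_bot (θ : AddCircle (2 * Real.pi)) (t : ℝ) : M.V00 F θ t ≠ ⊥ := by
  rw [V00]
  rcases min_choice (M.stay00 F t) (M.home00 F θ t) with h | h <;> rw [h]
  · exact EReal.coe_ne_bot _
  · simp [home00, EReal.add_eq_bot_iff, moveCost_ne_bot]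

lemma V00_ne_top (θ : AddCircle (2 * Real.pi)) (t : ℝ) : M.V00 F θ t ≠ ⊤ :=
  ((min_le_left _ _).trans_lt (EReal.coe_lt_top _)).ne

lemma VOne_ne_top (w : Label) (c : ℝ) (θ θ' : AddCircle (2 * Real.pi)) (t : ℝ) :
    M.VOne F w c θ θ' t ≠ ⊤ :=
  ((min_le_left _ _).trans_lt (EReal.coe_lt_top _)).ne

/-- Arrival times before the departure have infinite cost, so that the infimum can be taken over
an interval that does not depend on the departure time. -/
lemma iInf_visitOne_eq (w : Label) (θ θ' : AddCircle (2 * Real.pi)) {t : ℝ} (ht : 0 ≤ t) :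
    ⨅ τ ∈ Icc t M.T, M.visitOne F w θ θ' t τ
      = sInf ((fun τ => M.visitOne F w θ θ' t τ) '' Icc 0 M.T) := by
  rw [sInf_image]
  refine le_antisymm (le_iInf₂ fun τ hτ => ?_)
    (le_iInf₂ fun τ hτ => iInf₂_le τ (Icc_subset_Icc_left ht hτ))
  rcases le_or_gt t τ with h | h
  · exact iInf₂_le τ ⟨h, hτ.2⟩
  · refine le_of_le_of_eq le_top (visitCost_of_le F w _ (V00_ne_bot θ' τ) h.le).symm

lemma continuous_visitOne (hF : ∀ w, Continuous (F w)) (w : Label)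
    {θ θ' : AddCircle (2 * Real.pi)} (hθ : θ ≠ θ') (hθ' : θ' ≠ M.θS) :
    Continuous fun p : ℝ × ℝ => M.visitOne F w θ θ' p.1 p.2 := by
  have := continuousOn_visitCost hF w (dist_ne_zero.2 hθ) (S := univ)
    (continuous_V00 (M := M) hF hθ').continuousOn (fun τ _ => V00_ne_bot θ' τ)
  rw [univ_prod_univ, continuousOn_univ] at this
  exact this

lemma continuousOn_VOne (hF : ∀ w, Continuous (F w)) (w : Label) (c : ℝ)
    {θ θ' : AddCircle (2 * Real.pi)} (hθ : θ ≠ θ') (hθS : θ ≠ M.θS) (hθ' : θ' ≠ M.θS) :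
    ContinuousOn (M.VOne F w c θ θ') (Icc 0 M.T) := by
  have hi := continuous_integral_to (hF w) M.T
  have h1 : Continuous (M.stayOne F w c) :=
    continuous_coe_real_ereal.comp (continuous_const.add hi)
  have h2 : ContinuousOn (M.homeOne F w c θ) (Icc 0 M.T) := by
    refine (continuousOn_const.ereal_add (((continuous_moveCost (dist_ne_zero.2 hθS)).comp
      (continuous_const.sub continuous_id)).continuousOn) (fun _ _ => EReal.coe_ne_bot _)
      (fun _ _ => moveCost_ne_bot _ _)).ereal_add
      (continuous_coe_real_ereal.comp hi).continuousOn ?_ (fun _ _ => EReal.coe_ne_bot _)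
    intro t _
    simp [EReal.add_eq_bot_iff, moveCost_ne_bot]
  have h3 : Continuous fun t => sInf ((fun τ => M.visitOne F w θ θ' t τ) '' Icc 0 M.T) :=
    isCompact_Icc.continuous_sInf (f := fun t τ => M.visitOne F w θ θ' t τ)
      (continuous_visitOne hF w hθ hθ')
  exact h1.continuousOn.inf (h2.inf (h3.continuousOn.congr fun t ht =>
    iInf_visitOne_eq w θ θ' ht.1))

lemma VOne_ne_bot (hF : ∀ w, Continuous (F w)) (w : Label) (c : ℝ)
    {θ θ' : AddCircle (2 * Real.pi)} (hθ : θ ≠ θ') (hθ' : θ' ≠ M.θS) {t : ℝ}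
    (ht : t ∈ Icc 0 M.T) : M.VOne F w c θ θ' t ≠ ⊥ := by
  have h1 : M.stayOne F w c t ≠ ⊥ := EReal.coe_ne_bot _
  have h2 : M.homeOne F w c θ t ≠ ⊥ := by
    simp [homeOne, EReal.add_eq_bot_iff, moveCost_ne_bot]
  have h3 : ⨅ τ ∈ Icc t M.T, M.visitOne F w θ θ' t τ ≠ ⊥ := by
    obtain ⟨σ, -, hσ⟩ := (isCompact_Icc (a := t) (b := M.T)).exists_isMinOn
      (nonempty_Icc.2 ht.2) (f := fun τ => M.visitOne F w θ θ' t τ)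
      ((continuous_visitOne hF w hθ hθ').comp (by fun_prop :
        Continuous fun τ : ℝ => (t, τ))).continuousOn
    exact ne_bot_of_le_ne_bot (visitCost_ne_bot F w (dist θ θ') t (V00_ne_bot (M := M) θ' σ))
      (le_iInf₂ fun τ hτ => hσ hτ)
  rw [VOne]
  rcases min_choice (M.stayOne F w c t) (min (M.homeOne F w c θ t)
    (⨅ τ ∈ Icc t M.T, M.visitOne F w θ θ' t τ)) with h | h <;> rw [h]
  · exact h1
  · rcases min_choice (M.homeOne F w c θ t)
      (⨅ τ ∈ Icc t M.T, M.visitOne F w θ θ' t τ) with h | h <;> rw [h]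
    · exact h2
    · exact h3

end Model

end Values

/-! ### Best arrival times -/

section Minimizers

variable {F : Label → ℝ → ℝ} {w : Label} {d T : ℝ} {V : ℝ → EReal}

/-- The time `τ` minimizes the cost of a visit over the admissible arrival times. -/
def IsBestArrival (F : Label → ℝ → ℝ) (w : Label) (d T : ℝ) (V : ℝ → EReal) (t τ : ℝ) : Prop :=
  τ ∈ Icc t T ∧ ∀ σ ∈ Icc t T, visitCost F w d V t τ ≤ visitCost F w d V t σ

lemma exists_isBestArrival (hF : ∀ w, Continuous (F w)) (hd : d ≠ 0)
    (hV : ContinuousOn V (Icc 0 T)) (hV' : ∀ τ ∈ Icc 0 T, V τ ≠ ⊥) {t : ℝ} (ht : t ∈ Icc 0 T) :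
    ∃ τ, IsBestArrival F w d T V t τ := by
  have hsub : Icc t T ⊆ Icc 0 T := Icc_subset_Icc_left ht.1
  obtain ⟨σ, hσ, hmin⟩ := (isCompact_Icc (a := t) (b := T)).exists_isMinOn
    (nonempty_Icc.2 ht.2) (f := fun τ => visitCost F w d V t τ)
    ((continuousOn_visitCost hF w hd hV hV').comp (by fun_prop : Continuous fun τ : ℝ =>
      (t, τ)).continuousOn fun τ hτ => ⟨mem_univ _, hsub hτ⟩)
  exact ⟨σ, hσ, fun τ hτ => hmin hτ⟩

/-- Strict convexity of `1 / h`, in the form of a strict submodularity. -/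
lemma inv_add_inv_lt {a x y : ℝ} (ha : 0 < a) (hx : 0 < x) (hy : 0 < y) :
    1 / (a + x) + 1 / (a + y) < 1 / (a + x + y) + 1 / a := by
  have h1 : 1 / (a + x) - 1 / (a + x + y) = y / ((a + x) * (a + x + y)) := by field_simp; ring
  have h2 : 1 / a - 1 / (a + y) = y / (a * (a + y)) := by field_simp; ring
  have h3 : y / ((a + x) * (a + x + y)) < y / (a * (a + y)) := by
    apply div_lt_div_of_pos_left hy (by positivity)
    nlinarith [mul_pos ha hx, mul_pos hx hy, mul_pos hx hx]
  linarith

/-- Later departures have later best arrivals, because `d² / (2 (τ - t))` is strictly submodular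
in `(t, τ)` and the other terms of the cost split into a function of `t` and one of `τ`. -/
theorem IsBestArrival.le_of_lt (hF : ∀ w, Continuous (F w)) (hd : d ≠ 0)
    (hV' : ∀ τ ∈ Icc 0 T, V τ ≠ ⊥) (hV'' : ∀ τ ∈ Icc 0 T, V τ ≠ ⊤) {t t' τ τ' : ℝ} (ht : 0 ≤ t)
    (htt' : t < t') (ht' : t' < T) (hτ : IsBestArrival F w d T V t τ)
    (hτ' : IsBestArrival F w d T V t' τ') : τ ≤ τ' := by
  by_contra! hlt
  have hI : ∀ {x}, t ≤ x → x ≤ T → x ∈ Icc 0 T := fun h h' => ⟨ht.trans h, h'⟩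
  have hval : ∀ {s x}, s < x → x ∈ Icc 0 T → visitCost F w d V s x =
      ((d ^ 2 / (2 * (x - s)) + ((∫ r in (0 : ℝ)..x, F w r) - ∫ r in (0 : ℝ)..s, F w r)
        + (V x).toReal : ℝ) : EReal) := by
    intro s x hsx hx
    rw [visitCost, moveCost_of_pos (sub_pos.2 hsx), intervalIntegral.integral_interval_sub_left
      ((hF w).intervalIntegrable _ _) ((hF w).intervalIntegrable _ _), EReal.coe_add, EReal.coe_add,
      EReal.coe_toReal (hV'' x hx) (hV' x hx)]
  have ht'τ' : t' < τ' := by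
    refine lt_of_le_of_ne hτ'.1.1 fun h => ?_
    have h1 := hτ'.2 T ⟨ht'.le, le_rfl⟩
    rw [visitCost_of_le F w d (hV' τ' (hI (htt'.le.trans hτ'.1.1) hτ'.1.2)) h.ge,
      hval ht' (hI (htt'.trans ht').le le_rfl), top_le_iff] at h1
    exact EReal.coe_ne_top _ h1
  have hτI : τ ∈ Icc 0 T := hI hτ.1.1 hτ.1.2
  have hτ'I : τ' ∈ Icc 0 T := hI (htt'.le.trans hτ'.1.1) hτ'.1.2
  have h1 := hτ.2 τ' ⟨htt'.le.trans hτ'.1.1, hτ'.1.2⟩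
  have h2 := hτ'.2 τ ⟨(ht'τ'.trans hlt).le, hτ.1.2⟩
  rw [hval (htt'.trans (ht'τ'.trans hlt)) hτI, hval (htt'.trans ht'τ') hτ'I,
    EReal.coe_le_coe_iff] at h1
  rw [hval ht'τ' hτ'I, hval (ht'τ'.trans hlt) hτI, EReal.coe_le_coe_iff] at h2
  have h3 := inv_add_inv_lt (sub_pos.2 ht'τ') (sub_pos.2 htt') (sub_pos.2 hlt)
  have hk : ∀ x, d ^ 2 / (2 * x) = d ^ 2 / 2 * (1 / x) := fun x => by rw [div_mul_div_comm, mul_one]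
  rw [hk, hk] at h1 h2
  have hd2 : 0 < d ^ 2 / 2 := by positivity
  have h4 := mul_lt_mul_of_pos_left h3 hd2
  rw [show τ' - t' + (t' - t) = τ' - t by ring, show τ' - t' + (τ - τ') = τ - t' by ring,
    show τ' - t + (τ - τ') = τ - t by ring, mul_add, mul_add] at h4
  linarith

/-- A measurable choice of best arrival times, unique for almost all departure times: the choice
is monotone, and best arrivals are unique at its points of continuity. -/
theorem exists_measurable_bestArrival (hF : ∀ w, Continuous (F w)) (hd : d ≠ 0) (hT : 0 ≤ T)
    (hV : ContinuousOn V (Icc 0 T)) (hV' : ∀ τ ∈ Icc 0 T, V τ ≠ ⊥)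
    (hV'' : ∀ τ ∈ Icc 0 T, V τ ≠ ⊤) :
    ∃ τ₀ : ℝ → ℝ, Measurable τ₀ ∧ (∀ t ∈ Ioo 0 T, IsBestArrival F w d T V t (τ₀ t)) ∧
      ∀ᵐ t, t ∈ Ioo 0 T → ∀ σ, IsBestArrival F w d T V t σ → σ = τ₀ t := by
  choose! b hb using fun t (ht : t ∈ Icc 0 T) =>
    exists_isBestArrival (w := w) hF hd hV hV' ht
  let τ₀ : ℝ → ℝ := fun t => if t ≤ 0 then 0 else if t < T then b t else T
  have hmem : ∀ t ∈ Ioo 0 T, τ₀ t = b t := fun t ht => by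
    simp only [τ₀]; rw [if_neg ht.1.not_ge, if_pos ht.2]
  have hbest : ∀ t ∈ Ioo 0 T, IsBestArrival F w d T V t (τ₀ t) := fun t ht => by
    rw [hmem t ht]; exact hb t (Ioo_subset_Icc_self ht)
  have hmono : Monotone τ₀ := by
    intro s t hst
    rcases eq_or_lt_of_le hst with rfl | hst
    · exact le_rfl
    rcases le_or_gt s 0 with hs | hs
    · have : τ₀ s = 0 := if_pos hs
      rw [this]
      rcases le_or_gt t 0 with ht | ht
      · exact (if_pos ht : τ₀ t = 0).ge
      · rcases lt_or_ge t T with ht' | ht'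
        · exact ht.le.trans (hbest t ⟨ht, ht'⟩).1.1
        · have : τ₀ t = T := by simp only [τ₀]; rw [if_neg ht.not_ge, if_neg ht'.not_gt]
          rw [this]; exact hT
    · rcases lt_or_ge t T with ht' | ht'
      · exact (hbest s ⟨hs, hst.trans ht'⟩).le_of_lt hF hd hV' hV'' hs.le hst ht'
          (hbest t ⟨hs.trans hst, ht'⟩)
      · have : τ₀ t = T := by simp only [τ₀]; rw [if_neg (hs.trans hst).not_ge, if_neg ht'.not_gt]
        rw [this]
        rcases lt_or_ge s T with hs' | hs'
        · exact (hbest s ⟨hs, hs'⟩).1.2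
        · simp only [τ₀]; rw [if_neg hs.not_ge, if_neg hs'.not_gt]
  refine ⟨τ₀, hmono.measurable, hbest, ?_⟩
  filter_upwards [hmono.countable_not_continuousAt.ae_notMem volume] with t hc ht σ hσ
  have hcont : ContinuousAt τ₀ t := not_not.1 hc
  refine le_antisymm ?_ ?_
  · refine ge_of_tendsto (hcont.tendsto.mono_left (nhdsWithin_le_nhds (s := Ioi t))) ?_
    filter_upwards [Ioo_mem_nhdsGT ht.2] with s hs
    exact hσ.le_of_lt hF hd hV' hV'' ht.1.le hs.1 hs.2 (hbest s ⟨ht.1.trans hs.1, hs.2⟩)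
  · refine le_of_tendsto (hcont.tendsto.mono_left (nhdsWithin_le_nhds (s := Iio t))) ?_
    filter_upwards [Ioo_mem_nhdsLT ht.1] with s hs
    exact (hbest s ⟨hs.1, hs.2.trans ht.2⟩).le_of_lt hF hd hV' hV'' hs.1.le hs.2 ht.2 hσ

end Minimizers

/-! ### Limits of optimal visits, flows and masses -/

section Limits

/-- If visits are an optimal choice for infinitely many of the approximating problems, then the
best visit of the limit problem is optimal. -/
lemma eq_of_frequently_optimal {K : Set ℝ} {c : ℝ → EReal} {c' : ℕ → ℝ → EReal} {e : ℕ → ℝ}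
    (he : Tendsto e atTop (𝓝 0)) (hcc' : ∀ n, ∀ x ∈ K, Near (e n) (c' n x) (c x)) {v : EReal}
    {v' : ℕ → EReal} (hv : ∀ n, Near (e n) (v' n) v) (hle : ∀ n, ∀ x ∈ K, v' n ≤ c' n x) {x₀ : ℝ}
    (hx₀ : x₀ ∈ K) (hmin : ∀ x ∈ K, c x₀ ≤ c x)
    (hfr : ∃ᶠ n in atTop, ∃ x ∈ K, c' n x = v' n) : c x₀ = v := by
  have he2 : Tendsto (fun n => e n + e n) atTop (𝓝 0) := by simpa using he.add he
  refine le_antisymm (le_of_frequently_le_add he2 (hfr.mono ?_))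
    (le_of_frequently_le_add he2 (hfr.mono fun n _ => ?_))
  · rintro n ⟨x, hx, hxv⟩
    rw [EReal.coe_add, ← add_assoc]
    refine (hmin x hx).trans ((hcc' n x hx).2.trans ?_)
    rw [hxv]; gcongr; exact (hv n).1
  · rw [EReal.coe_add, ← add_assoc]
    refine (hv n).2.trans ?_
    gcongr
    exact (hle n x₀ hx₀).trans (hcc' n x₀ hx₀).1

/-- Limits of optimal visits: the arrival times in use converge to the best arrival time of the
limit problem for almost every departure time, and the visit is an optimal choice in the limit
wherever it is one for infinitely many approximating problems. -/
theorem exists_limit_bestArrival {T : ℝ} (hT : 0 ≤ T) {F₀ : Label → ℝ → ℝ}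
    (hF₀ : ∀ w, Continuous (F₀ w)) (w : Label) {d : ℝ} (hd : d ≠ 0) {V₀ : ℝ → EReal}
    (hV : ContinuousOn V₀ (Icc 0 T)) (hV' : ∀ τ ∈ Icc 0 T, V₀ τ ≠ ⊥)
    (hV'' : ∀ τ ∈ Icc 0 T, V₀ τ ≠ ⊤) {e : ℕ → ℝ} (he : Tendsto e atTop (𝓝 0))
    {c : ℕ → ℝ → ℝ → EReal} (hc : ∀ n, ∀ t ∈ Icc 0 T, ∀ τ ∈ Icc t T,
      Near (e n) (c n t τ) (visitCost F₀ w d V₀ t τ))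
    {v : ℕ → ℝ → EReal} {v₀ : ℝ → EReal} (hv : ∀ n, ∀ t ∈ Icc 0 T, Near (e n) (v n t) (v₀ t))
    (hvc : ∀ n t, ∀ τ ∈ Icc t T, v n t ≤ c n t τ) {lam τ : ℕ → ℝ → ℝ}
    (hopt : ∀ n, ∀ᵐ t ∂(volume.restrict (Ioo 0 T)),
      lam n t ≠ 0 → τ n t ∈ Icc t T ∧ c n t (τ n t) = v n t) :
    ∃ τ₀ : ℝ → ℝ, Measurable τ₀ ∧
      (∀ᵐ t ∂(volume.restrict (Icc 0 T)), ∀ ε > 0, ∀ᶠ n in atTop,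
        lam n t ≠ 0 → |τ n t - τ₀ t| < ε) ∧
      ∀ᵐ t ∂(volume.restrict (Ioo 0 T)), (∃ᶠ n in atTop, lam n t ≠ 0) →
        τ₀ t ∈ Icc t T ∧ visitCost F₀ w d V₀ t (τ₀ t) = v₀ t := by
  obtain ⟨τ₀, hm, hbest, huniq⟩ := exists_measurable_bestArrival (w := w) hF₀ hd hT hV hV' hV''
  have hopt' := ae_all_iff.2 hopt
  refine ⟨τ₀, hm, ?_, ?_⟩
  · rw [← restrict_Ioo_eq_restrict_Icc]
    filter_upwards [hopt', ae_restrict_of_ae huniq, ae_restrict_mem measurableSet_Ioo] with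
      t ho hu ht ε hε
    have htI := Ioo_subset_Icc_self ht
    have hcont : ContinuousOn (fun τ => visitCost F₀ w d V₀ t τ) (Icc t T) :=
      (continuousOn_visitCost hF₀ w hd hV hV').comp (by fun_prop : Continuous fun τ : ℝ =>
        (t, τ)).continuousOn fun τ hτ => ⟨mem_univ _, Icc_subset_Icc_left ht.1.le hτ⟩
    filter_upwards [eventually_abs_sub_argmin_lt isCompact_Icc hcont he
      (fun n x hx => hc n t htI x hx) (hbest t ht).1 (hbest t ht).2
      (fun x hx hmin => hu ht x ⟨hx, hmin⟩) hε] with n hn hne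
    obtain ⟨h1, h2⟩ := ho n hne
    exact hn _ h1 fun y hy => h2.le.trans (hvc n t y hy)
  · filter_upwards [hopt', ae_restrict_mem measurableSet_Ioo] with t ho ht hfr
    have htI := Ioo_subset_Icc_self ht
    exact ⟨(hbest t ht).1, eq_of_frequently_optimal he (fun n x hx => hc n t htI x hx)
      (fun n => hv n t htI) (fun n x hx => hvc n t x hx) (hbest t ht).1 (hbest t ht).2
      (hfr.mono fun n hn => ⟨_, ho n hn⟩)⟩

namespace Model

variable (M : Model)

/-- The flows of an equilibrium are bounded by `sup g + 2 L`: the masses change at a rate of at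
least `-L`, which bounds the flow out of a branch by the flow into it plus `L`. -/
lemma ae_flow_le {L : ℝ≥0} {C : ℝ} (hC : ∀ t ∈ Icc 0 M.T, M.g t ≤ C) {lam : SplitString}
    {τ₁ τ₂ τ₁₂ τ₂₁ g₀₁ g₁₀ g₁₂ g₂₁ : ℝ → ℝ} {ρ : Label → ℝ → ℝ} (hρ : ρ ∈ M.X L)
    (h : M.Generates lam τ₁ τ₂ τ₁₂ τ₂₁ g₀₁ g₁₀ g₁₂ g₂₁ ρ) :
    ∀ q ∈ ({g₀₁, g₁₀, g₁₂, g₂₁} : Set (ℝ → ℝ)),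
      ∀ᵐ t ∂(volume.restrict (Icc 0 M.T)), 0 ≤ q t ∧ q t ≤ C + 2 * L := by
  have hT := M.T_pos.le
  have hii : ∀ {q : ℝ → ℝ}, IntegrableOn q (Icc 0 M.T) → ∀ {s t}, s ∈ Icc 0 M.T → t ∈ Icc 0 M.T →
      IntervalIntegrable q volume s t := fun hq s t hs ht =>
    (hq.mono_set (uIcc_subset_Icc hs ht)).intervalIntegrable
  have hsub : ∀ {q : ℝ → ℝ}, IntegrableOn q (Icc 0 M.T) → ∀ {s t}, s ∈ Icc 0 M.T → t ∈ Icc 0 M.T →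
      ∫ x in s..t, q x = (∫ x in (0 : ℝ)..t, q x) - ∫ x in (0 : ℝ)..s, q x :=
    fun hq s t hs ht => (intervalIntegral.integral_interval_sub_left
      (hii hq (left_mem_Icc.2 hT) ht) (hii hq (left_mem_Icc.2 hT) hs)).symm
  have hnn : ∀ {q : ℝ → ℝ}, (∀ᵐ t ∂(volume.restrict (Ioo 0 M.T)), 0 ≤ q t) →
      ∀ {s t}, s ∈ Icc 0 M.T → t ∈ Icc 0 M.T → s ≤ t → 0 ≤ ∫ x in s..t, q x :=
    fun hq s t hs ht hst => by
      rw [restrict_Ioo_eq_restrict_Icc] at hq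
      exact intervalIntegral.integral_nonneg_of_ae_restrict hst
        (ae_mono (Measure.restrict_mono (Icc_subset_Icc hs.1 ht.2) le_rfl) hq)
  have hlip : ∀ w {s t}, s ∈ Icc 0 M.T → t ∈ Icc 0 M.T → s ≤ t →
      ρ w s - ρ w t ≤ L * (t - s) := fun w s t hs ht hst => by
    have := (hρ w).1.dist_le_mul s hs t ht
    rw [Real.dist_eq, Real.dist_eq, abs_sub_comm s t, abs_of_nonneg (sub_nonneg.2 hst)] at this
    exact (le_abs_self _).trans this
  have hg : ∀ {s t}, s ∈ Icc 0 M.T → t ∈ Icc 0 M.T → s ≤ t →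
      ∫ x in s..t, M.g x ≤ C * (t - s) := fun {s t} hs ht hst => by
    have := intervalIntegral.integral_mono_on hst (hii (M.g_cont.integrableOn_Icc) hs ht)
      (intervalIntegrable_const (c := C)) fun x hx => hC x ⟨hs.1.trans hx.1, hx.2.trans ht.2⟩
    rw [intervalIntegral.integral_const, smul_eq_mul, mul_comm] at this
    exact this
  have hgi := M.g_cont.integrableOn_Icc (μ := volume)
  obtain ⟨i01, p01, -⟩ := h.flow01
  obtain ⟨i10, p10, -⟩ := h.flow10
  obtain ⟨i12, p12, -⟩ := h.flow12
  obtain ⟨i21, p21, -⟩ := h.flow21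
  have hL : (0 : ℝ) ≤ L := L.2
  have b1 : ∀ {s t}, s ∈ Icc 0 M.T → t ∈ Icc 0 M.T → s ≤ t →
      (∫ x in s..t, g₀₁ x) ≤ (C + L) * (t - s) ∧ (∫ x in s..t, g₁₀ x) ≤ (C + L) * (t - s) := by
    intro s t hs ht hst
    have h1 := hg hs ht hst
    have h2 := hlip (1, 1) hs ht hst
    have h3 := hnn p01 hs ht hst
    have h4 := hnn p10 hs ht hst
    rw [h.mass11 s hs, h.mass11 t ht] at h2
    rw [hsub hgi hs ht] at h1
    rw [hsub i01 hs ht] at h3 ⊢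
    rw [hsub i10 hs ht] at h4 ⊢
    constructor <;> linarith
  have b2 : ∀ {s t}, s ∈ Icc 0 M.T → t ∈ Icc 0 M.T → s ≤ t →
      (∫ x in s..t, g₁₂ x) ≤ (C + 2 * L) * (t - s) ∧
      (∫ x in s..t, g₂₁ x) ≤ (C + 2 * L) * (t - s) := by
    intro s t hs ht hst
    obtain ⟨h1, h1'⟩ := b1 hs ht hst
    have h2 := hlip (0, 1) hs ht hst
    have h3 := hlip (1, 0) hs ht hst
    rw [h.mass01 s hs, h.mass01 t ht] at h2
    rw [h.mass10 s hs, h.mass10 t ht] at h3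
    rw [hsub i01 hs ht] at h1
    rw [hsub i10 hs ht] at h1'
    rw [hsub i12 hs ht, hsub i21 hs ht]
    constructor <;> linarith
  have hmono : ∀ {s t : ℝ}, s ≤ t → (C + L) * (t - s) ≤ (C + 2 * L) * (t - s) := fun hst =>
    mul_le_mul_of_nonneg_right (by linarith) (sub_nonneg.2 hst)
  rw [restrict_Ioo_eq_restrict_Icc] at p01 p10 p12 p21
  rintro q (rfl | rfl | rfl | rfl)
  · exact p01.and (ae_le_of_intervalIntegral_le hT i01 fun s hs t ht hst =>
      (b1 hs ht hst).1.trans (hmono hst))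
  · exact p10.and (ae_le_of_intervalIntegral_le hT i10 fun s hs t ht hst =>
      (b1 hs ht hst).2.trans (hmono hst))
  · exact p12.and (ae_le_of_intervalIntegral_le hT i12 fun s hs t ht hst => (b2 hs ht hst).1)
  · exact p21.and (ae_le_of_intervalIntegral_le hT i21 fun s hs t ht hst => (b2 hs ht hst).2)

lemma continuousOn_of_mem_X {L : ℝ≥0} {ρ : Label → ℝ → ℝ} (hρ : ρ ∈ M.X L) (w : Label) :
    ContinuousOn (ρ w) (Icc 0 M.T) := (hρ w).1.continuousOn

lemma mem_X_of_tendsto {L : ℝ≥0} {ρ : ℕ → Label → ℝ → ℝ} {ρ₀ : Label → ℝ → ℝ}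
    (hρ : ∀ n, ρ n ∈ M.X L)
    (hlim : ∀ w, ∀ t ∈ Icc 0 M.T, Tendsto (fun n => ρ n w t) atTop (𝓝 (ρ₀ w t))) :
    ρ₀ ∈ M.X L := by
  refine fun w => ⟨LipschitzOnWith.of_dist_le_mul fun s hs t ht => ?_, fun t ht => ⟨?_, ?_⟩⟩
  · exact le_of_tendsto' ((hlim w s hs).dist (hlim w t ht)) fun n =>
      (hρ n w).1.dist_le_mul s hs t ht
  · exact ge_of_tendsto' (hlim w t ht) fun n => ((hρ n w).2 t ht).1
  · exact le_of_tendsto' (hlim w t ht) fun n => ((hρ n w).2 t ht).2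

/-- Congestion costs converge uniformly when parameters and masses do. -/
lemma exists_nearCosts {L : ℝ≥0} {α β : ℕ → Label → ℝ} {α₀ β₀ : Label → ℝ}
    (hα : Tendsto α atTop (𝓝 α₀)) (hβ : Tendsto β atTop (𝓝 β₀)) {ρ : ℕ → Label → ℝ → ℝ}
    {ρ₀ : Label → ℝ → ℝ} (hρ : ∀ n, ρ n ∈ M.X L) (hρ₀ : ∀ w, Continuous (ρ₀ w)) {δ : ℕ → ℝ}
    (hδ : Tendsto δ atTop (𝓝 0)) (hρδ : ∀ n w, ∀ t ∈ Icc 0 M.T, |ρ n w t - ρ₀ w t| ≤ δ n) :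
    ∃ e : ℕ → ℝ, Tendsto e atTop (𝓝 0) ∧
      ∀ n, M.NearCosts (e n) (congestion (α n) (β n) (ρ n)) (congestion α₀ β₀ ρ₀) := by
  let R : ℝ := ∫ s in (0 : ℝ)..M.T, M.g s
  refine ⟨fun n => (‖α n - α₀‖ * R + ‖α₀‖ * δ n + ‖β n - β₀‖) * M.T, ?_, fun n => ?_⟩
  · have h1 : Tendsto (fun n => ‖α n - α₀‖) atTop (𝓝 0) := tendsto_iff_norm_sub_tendsto_zero.1 hα
    have h2 : Tendsto (fun n => ‖β n - β₀‖) atTop (𝓝 0) := tendsto_iff_norm_sub_tendsto_zero.1 hβ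
    simpa using (((h1.mul_const R).add (hδ.const_mul ‖α₀‖)).add h2).mul_const M.T
  · intro w t τ ht htτ hτ
    refine near_intervalIntegral ?_ ?_ (fun s hs => ?_) ht htτ hτ
    · exact (continuousOn_const.mul (M.continuousOn_of_mem_X (hρ n) w)).add continuousOn_const
    · exact ((continuous_const.mul (hρ₀ w)).add continuous_const).continuousOn
    · have h1 : |α n w - α₀ w| ≤ ‖α n - α₀‖ := norm_le_pi_norm (α n - α₀) w
      have h2 : |α₀ w| ≤ ‖α₀‖ := norm_le_pi_norm α₀ w
      have h3 : |β n w - β₀ w| ≤ ‖β n - β₀‖ := norm_le_pi_norm (β n - β₀) w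
      have h4 : |ρ n w s| ≤ R := by
        rw [abs_of_nonneg ((hρ n w).2 s hs).1]
        exact ((hρ n w).2 s hs).2
      have : congestion (α n) (β n) (ρ n) w s - congestion α₀ β₀ ρ₀ w s
          = (α n w - α₀ w) * ρ n w s + α₀ w * (ρ n w s - ρ₀ w s) + (β n w - β₀ w) := by
        simp only [congestion]; ring
      rw [this]
      refine (abs_add_three _ _ _).trans ?_
      rw [abs_mul, abs_mul]
      gcongr
      exact hρδ n w s hs

end Model

end Limits

/-! ### Closed graph of the equilibrium correspondence -/

section ClosedGraph

namespace Model

variable (M : Model)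

/-- The equilibrium correspondence has a closed graph: a uniform limit of equilibrium masses for
converging parameters consists of equilibrium masses for the limit parameters. -/
theorem mem_equilibria_of_tendsto {L : ℝ≥0} {α β : ℕ → Label → ℝ} {α₀ β₀ : Label → ℝ}
    (hα : Tendsto α atTop (𝓝 α₀)) (hβ : Tendsto β atTop (𝓝 β₀)) {ρ : ℕ → Label → ℝ → ℝ}
    {ρ₀ : Label → ℝ → ℝ} (hρ : ∀ n, ρ n ∈ M.equilibria L (α n) (β n))
    (hρ₀ : ∀ w, Continuous (ρ₀ w)) {δ : ℕ → ℝ} (hδ : Tendsto δ atTop (𝓝 0))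
    (hρδ : ∀ n w, ∀ t ∈ Icc 0 M.T, |ρ n w t - ρ₀ w t| ≤ δ n) :
    ρ₀ ∈ M.equilibria L α₀ β₀ := by
  choose lam hX hS τ₁ τ₂ τ₁₂ τ₂₁ g₀₁ g₁₀ g₁₂ g₂₁ hτ₁ hτ₂ hτ₁₂ hτ₂₁ hopt hgen using hρ
  have hT := M.T_pos.le
  have hlim : ∀ w, ∀ t ∈ Icc 0 M.T, Tendsto (fun n => ρ n w t) atTop (𝓝 (ρ₀ w t)) :=
    fun w t ht => tendsto_iff_dist_tendsto_zero.2
      (squeeze_zero (fun _ => dist_nonneg) (fun n => hρδ n w t ht) hδ)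
  have hX₀ : ρ₀ ∈ M.X L := M.mem_X_of_tendsto hX hlim
  obtain ⟨e, he, hnear⟩ := M.exists_nearCosts hα hβ hX hρ₀ hδ hρδ
  have he2 : Tendsto (fun n => e n + e n) atTop (𝓝 0) := by simpa using he.add he
  have he3 : Tendsto (fun n => e n + (e n + e n)) atTop (𝓝 0) := by simpa using he.add he2
  have hle2 : ∀ n, e n ≤ e n + e n := fun n => le_add_of_nonneg_left (hnear n).nonneg
  have hle3 : ∀ n, e n ≤ e n + (e n + e n) := fun n => by linarith [(hnear n).nonneg]
  set F : ℕ → Label → ℝ → ℝ := fun n => congestion (α n) (β n) (ρ n)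
  set F₀ : Label → ℝ → ℝ := congestion α₀ β₀ ρ₀
  have hF₀ : ∀ w, Continuous (F₀ w) := fun w =>
    (continuous_const.mul (hρ₀ w)).add continuous_const
  -- the arrival times in the limit
  obtain ⟨σ₁, hσ₁, hσ₁c, hσ₁o⟩ := exists_limit_bestArrival (T := M.T) hT hF₀ (1, 1)
    (dist_ne_zero.2 M.θS_ne_θ₁) (V₀ := M.V01 F₀)
    (continuousOn_VOne hF₀ _ _ M.θ₁_ne_θ₂ M.θS_ne_θ₁.symm M.θS_ne_θ₂.symm)
    (fun τ hτ => VOne_ne_bot hF₀ _ _ M.θ₁_ne_θ₂ M.θS_ne_θ₂.symm hτ)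
    (fun τ _ => VOne_ne_top _ _ _ _ τ) he3 (c := fun n => M.visit11_1 (F n))
    (fun n t ht τ hτ => (hnear n).visit11_1 ht hτ) (v := fun n => M.V11 (F n)) (v₀ := M.V11 F₀)
    (fun n t ht => (hnear n).V11 ht)
    (fun n t τ hτ => (min_le_right _ _).trans ((min_le_left _ _).trans (iInf₂_le τ hτ)))
    (lam := fun n => (lam n).atS11 1) (τ := τ₁)
    (fun n => (hopt n).atS11.mono fun t ht => ht.2.1)
  obtain ⟨σ₂, hσ₂, hσ₂c, hσ₂o⟩ := exists_limit_bestArrival (T := M.T) hT hF₀ (1, 1)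
    (dist_ne_zero.2 M.θS_ne_θ₂) (V₀ := M.V10 F₀)
    (continuousOn_VOne hF₀ _ _ M.θ₁_ne_θ₂.symm M.θS_ne_θ₂.symm M.θS_ne_θ₁.symm)
    (fun τ hτ => VOne_ne_bot hF₀ _ _ M.θ₁_ne_θ₂.symm M.θS_ne_θ₁.symm hτ)
    (fun τ _ => VOne_ne_top _ _ _ _ τ) he3 (c := fun n => M.visit11_2 (F n))
    (fun n t ht τ hτ => (hnear n).visit11_2 ht hτ) (v := fun n => M.V11 (F n)) (v₀ := M.V11 F₀)
    (fun n t ht => (hnear n).V11 ht)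
    (fun n t τ hτ => (min_le_right _ _).trans ((min_le_right _ _).trans (iInf₂_le τ hτ)))
    (lam := fun n => (lam n).atS11 2) (τ := τ₂)
    (fun n => (hopt n).atS11.mono fun t ht => ht.2.2)
  obtain ⟨σ₁₂, hσ₁₂, hσ₁₂c, hσ₁₂o⟩ := exists_limit_bestArrival (T := M.T) hT hF₀ (0, 1)
    (dist_ne_zero.2 M.θ₁_ne_θ₂) (V₀ := M.V00 F₀ M.θ₂)
    (continuous_V00 hF₀ M.θS_ne_θ₂.symm).continuousOn
    (fun τ _ => V00_ne_bot _ τ) (fun τ _ => V00_ne_top _ τ) he2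
    (c := fun n => M.visitOne (F n) (0, 1) M.θ₁ M.θ₂)
    (fun n t ht τ hτ => (hnear n).visitOne _ _ _ ht hτ) (v := fun n => M.V01 (F n))
    (v₀ := M.V01 F₀) (fun n t ht => (hnear n).VOne _ _ _ _ ht)
    (fun n t τ hτ => (min_le_right _ _).trans ((min_le_right _ _).trans (iInf₂_le τ hτ)))
    (lam := fun n => (lam n).at101 2) (τ := τ₁₂)
    (fun n => (hopt n).at101.mono fun t ht => ht.2.2)
  obtain ⟨σ₂₁, hσ₂₁, hσ₂₁c, hσ₂₁o⟩ := exists_limit_bestArrival (T := M.T) hT hF₀ (1, 0)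
    (dist_ne_zero.2 M.θ₁_ne_θ₂.symm) (V₀ := M.V00 F₀ M.θ₁)
    (continuous_V00 hF₀ M.θS_ne_θ₁.symm).continuousOn
    (fun τ _ => V00_ne_bot _ τ) (fun τ _ => V00_ne_top _ τ) he2
    (c := fun n => M.visitOne (F n) (1, 0) M.θ₂ M.θ₁)
    (fun n t ht τ hτ => (hnear n).visitOne _ _ _ ht hτ) (v := fun n => M.V10 (F n))
    (v₀ := M.V10 F₀) (fun n t ht => (hnear n).VOne _ _ _ _ ht)
    (fun n t τ hτ => (min_le_right _ _).trans ((min_le_right _ _).trans (iInf₂_le τ hτ)))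
    (lam := fun n => (lam n).at210 2) (τ := τ₂₁)
    (fun n => (hopt n).at210.mono fun t ht => ht.2.2)
  -- the flows and the fractions in the limit
  obtain ⟨U, hU⟩ : ∃ U : Ultrafilter ℕ, (U : Filter ℕ) ≤ atTop := Ultrafilter.exists_le atTop
  obtain ⟨C, hC⟩ := isCompact_Icc.bddAbove_image M.g_cont
  have hgC : ∀ t ∈ Icc 0 M.T, M.g t ≤ C := fun t ht => hC (mem_image_of_mem _ ht)
  set μ : Measure ℝ := volume.restrict (Icc 0 M.T) with hμ
  have hμ' : volume.restrict (Ioo 0 M.T) = μ := restrict_Ioo_eq_restrict_Icc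
  have hflow := fun n => M.ae_flow_le hgC (hX n) (hgen n)
  have hB01 : ∀ n, ∀ᵐ t ∂μ, 0 ≤ g₀₁ n t ∧ g₀₁ n t ≤ C + 2 * L := fun n => hflow n _ (by simp)
  have hB10 : ∀ n, ∀ᵐ t ∂μ, 0 ≤ g₁₀ n t ∧ g₁₀ n t ≤ C + 2 * L := fun n => hflow n _ (by simp)
  have hB12 : ∀ n, ∀ᵐ t ∂μ, 0 ≤ g₁₂ n t ∧ g₁₂ n t ≤ C + 2 * L := fun n => hflow n _ (by simp)
  have hB21 : ∀ n, ∀ᵐ t ∂μ, 0 ≤ g₂₁ n t ∧ g₂₁ n t ≤ C + 2 * L := fun n => hflow n _ (by simp)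
  have hBg : ∀ᵐ t ∂μ, 0 ≤ M.g t ∧ M.g t ≤ C + 2 * L := by
    filter_upwards [ae_restrict_mem measurableSet_Icc] with t ht
    exact ⟨M.g_nonneg t ht, (hgC t ht).trans (le_add_of_nonneg_right (by positivity))⟩
  have hm01 : ∀ n, AEStronglyMeasurable (g₀₁ n) μ := fun n => (hgen n).flow01.1.aestronglyMeasurable
  have hm10 : ∀ n, AEStronglyMeasurable (g₁₀ n) μ := fun n => (hgen n).flow10.1.aestronglyMeasurable
  have hm12 : ∀ n, AEStronglyMeasurable (g₁₂ n) μ := fun n => (hgen n).flow12.1.aestronglyMeasurable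
  have hm21 : ∀ n, AEStronglyMeasurable (g₂₁ n) μ := fun n => (hgen n).flow21.1.aestronglyMeasurable
  have hgi : Integrable M.g μ := M.g_cont.integrableOn_Icc
  obtain ⟨k₀₁, km01, kb01, kl01⟩ := exists_setTendsto U hm01 hB01
  obtain ⟨k₁₀, km10, kb10, kl10⟩ := exists_setTendsto U hm10 hB10
  obtain ⟨k₁₂, km12, kb12, kl12⟩ := exists_setTendsto U hm12 hB12
  obtain ⟨k₂₁, km21, kb21, kl21⟩ := exists_setTendsto U hm21 hB21
  have ki01 := integrable_of_ae_mem_Icc km01.aestronglyMeasurable kb01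
  have ki10 := integrable_of_ae_mem_Icc km10.aestronglyMeasurable kb10
  have ki12 := integrable_of_ae_mem_Icc km12.aestronglyMeasurable kb12
  have ki21 := integrable_of_ae_mem_Icc km21.aestronglyMeasurable kb21
  have hsplit : ∀ {k : ℕ} {l : Fin k → ℝ → ℝ}, M.IsSplit l →
      ∀ᵐ t ∂μ, (∀ i, 0 ≤ l i t) ∧ ∑ i, l i t = 1 := fun h => hμ' ▸ h.2
  have hg0 : SetTendsto U μ (fun _ => M.g) M.g := fun _ _ => tendsto_const_nhds
  obtain ⟨lS, lSm, lSs, lSl, lSf⟩ := exists_split_limit hU (fun n => (hS n).atS11.1)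
    (fun n => hsplit (hS n).atS11) (fun _ => hgi.1) (fun _ => hBg) hgi hg0
  obtain ⟨l1, l1m, l1s, l1l, l1f⟩ := exists_split_limit hU (fun n => (hS n).at101.1)
    (fun n => hsplit (hS n).at101) hm01 hB01 ki01 kl01
  obtain ⟨l2, l2m, l2s, l2l, l2f⟩ := exists_split_limit hU (fun n => (hS n).at210.1)
    (fun n => hsplit (hS n).at210) hm10 hB10 ki10 kl10
  -- no flow has to be followed after both visits, so any flow does for these fractions
  obtain ⟨l3, l3m, l3s, -, l3f⟩ := exists_split_limit hU (fun n => (hS n).at100.1)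
    (fun n => hsplit (hS n).at100) (fun _ => hgi.1) (fun _ => hBg) hgi hg0
  obtain ⟨l4, l4m, l4s, -, l4f⟩ := exists_split_limit hU (fun n => (hS n).at200.1)
    (fun n => hsplit (hS n).at200) (fun _ => hgi.1) (fun _ => hBg) hgi hg0
  have hprod : ∀ {k : ℕ} {l : Fin k → ℝ → ℝ} (i : Fin k), M.IsSplit l → ∀ {f : ℝ → ℝ},
      AEStronglyMeasurable f μ → (∀ᵐ t ∂μ, 0 ≤ f t ∧ f t ≤ C + 2 * L) →
      AEStronglyMeasurable (fun t => l i t * f t) μ ∧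
        ∀ᵐ t ∂μ, 0 ≤ l i t * f t ∧ l i t * f t ≤ C + 2 * L := by
    intro k l i hl f hfm hf
    refine ⟨(hl.1 i).aestronglyMeasurable.mul hfm, ?_⟩
    filter_upwards [hsplit hl, hf] with t h1 h2
    have hle : l i t ≤ 1 := h1.2 ▸ Finset.single_le_sum (fun j _ => h1.1 j) (Finset.mem_univ i)
    exact ⟨mul_nonneg (h1.1 i) h2.1, (mul_le_of_le_one_left h2.1 hle).trans h2.2⟩
  have hτc : ∀ {l τ f : ℕ → ℝ → ℝ} {σ : ℝ → ℝ}, (∀ᵐ t ∂μ, ∀ ε > 0, ∀ᶠ n in atTop,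
      l n t ≠ 0 → |τ n t - σ t| < ε) → ∀ᵐ t ∂μ, ∀ ε > 0, ∀ᶠ n in atTop,
      l n t * f n t ≠ 0 → |τ n t - σ t| < ε := fun h =>
    h.mono fun t ht ε hε => (ht ε hε).mono fun n hn hne => hn (left_ne_zero_of_mul hne)
  refine ⟨⟨lS, l1, l2, l3, l4⟩, hX₀, ⟨⟨lSm, hμ'.symm ▸ lSs⟩, ⟨l1m, hμ'.symm ▸ l1s⟩,
    ⟨l2m, hμ'.symm ▸ l2s⟩, ⟨l3m, hμ'.symm ▸ l3s⟩, ⟨l4m, hμ'.symm ▸ l4s⟩⟩, σ₁, σ₂, σ₁₂, σ₂₁,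
    k₀₁, k₁₀, k₁₂, k₂₁, hσ₁, hσ₂, hσ₁₂, hσ₂₁, ?_, ?_⟩
  · rw [← hμ'] at lSf l1f l2f l3f l4f
    have hmem : ∀ᵐ t ∂(volume.restrict (Ioo 0 M.T)), t ∈ Icc 0 M.T :=
      (ae_restrict_mem measurableSet_Ioo).mono fun t ht => Ioo_subset_Icc_self ht
    constructor
    · filter_upwards [lSf, hσ₁o, hσ₂o, ae_all_iff.2 fun n => (hopt n).atS11, hmem] with
        t hf h1 h2 ho ht
      exact ⟨fun hne => eq_of_frequently_eq he3 (fun n => ((hnear n).stay11 ht).mono (hle3 n))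
          (fun n => (hnear n).V11 ht) ((hf 0 hne).mono fun n hn => (ho n).1 hn),
        fun hne => h1 (hf 1 hne), fun hne => h2 (hf 2 hne)⟩
    · filter_upwards [l1f, hσ₁₂o, ae_all_iff.2 fun n => (hopt n).at101, hmem] with t hf h1 ho ht
      exact ⟨fun hne => eq_of_frequently_eq he2
          (fun n => ((hnear n).stayOne _ _ ht).mono (hle2 n))
          (fun n => (hnear n).VOne _ _ _ _ ht) ((hf 0 hne).mono fun n hn => (ho n).1 hn),
        fun hne => eq_of_frequently_eq he2 (fun n => ((hnear n).homeOne _ _ _ ht).mono (hle2 n))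
          (fun n => (hnear n).VOne _ _ _ _ ht) ((hf 1 hne).mono fun n hn => (ho n).2.1 hn),
        fun hne => h1 (hf 2 hne)⟩
    · filter_upwards [l2f, hσ₂₁o, ae_all_iff.2 fun n => (hopt n).at210, hmem] with t hf h1 ho ht
      exact ⟨fun hne => eq_of_frequently_eq he2
          (fun n => ((hnear n).stayOne _ _ ht).mono (hle2 n))
          (fun n => (hnear n).VOne _ _ _ _ ht) ((hf 0 hne).mono fun n hn => (ho n).1 hn),
        fun hne => eq_of_frequently_eq he2 (fun n => ((hnear n).homeOne _ _ _ ht).mono (hle2 n))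
          (fun n => (hnear n).VOne _ _ _ _ ht) ((hf 1 hne).mono fun n hn => (ho n).2.1 hn),
        fun hne => h1 (hf 2 hne)⟩
    · filter_upwards [l3f, ae_all_iff.2 fun n => (hopt n).at100, hmem] with t hf ho ht
      exact ⟨fun hne => eq_of_frequently_eq he (fun n => (hnear n).stay00 ht)
          (fun n => (hnear n).V00 _ ht) ((hf 0 hne).mono fun n hn => (ho n).1 hn),
        fun hne => eq_of_frequently_eq he (fun n => (hnear n).home00 _ ht)
          (fun n => (hnear n).V00 _ ht) ((hf 1 hne).mono fun n hn => (ho n).2 hn)⟩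
    · filter_upwards [l4f, ae_all_iff.2 fun n => (hopt n).at200, hmem] with t hf ho ht
      exact ⟨fun hne => eq_of_frequently_eq he (fun n => (hnear n).stay00 ht)
          (fun n => (hnear n).V00 _ ht) ((hf 0 hne).mono fun n hn => (ho n).1 hn),
        fun hne => eq_of_frequently_eq he (fun n => (hnear n).home00 _ ht)
          (fun n => (hnear n).V00 _ ht) ((hf 1 hne).mono fun n hn => (ho n).2 hn)⟩
  · have hmass : ∀ w, ∀ t ∈ Icc 0 M.T, Tendsto (fun n => ρ n w t) U (𝓝 (ρ₀ w t)) :=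
      fun w t ht => (hlim w t ht).mono_left hU
    constructor
    · exact isArrivalFlow_of_setTendsto M hU
        (fun n => (hprod 1 (hS n).atS11 hgi.1 hBg).1) (fun n => (hprod 1 (hS n).atS11 hgi.1 hBg).2)
        (lSl 1) hτ₁ hσ₁ (hτc hσ₁c) (fun n => (hgen n).flow01) ki01 (kb01.mono fun t ht => ht.1) kl01
    · exact isArrivalFlow_of_setTendsto M hU
        (fun n => (hprod 2 (hS n).atS11 hgi.1 hBg).1) (fun n => (hprod 2 (hS n).atS11 hgi.1 hBg).2)
        (lSl 2) hτ₂ hσ₂ (hτc hσ₂c) (fun n => (hgen n).flow10) ki10 (kb10.mono fun t ht => ht.1) kl10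
    · exact isArrivalFlow_of_setTendsto M hU
        (fun n => (hprod 2 (hS n).at101 (hm01 n) (hB01 n)).1)
        (fun n => (hprod 2 (hS n).at101 (hm01 n) (hB01 n)).2)
        (l1l 2) hτ₁₂ hσ₁₂ (hτc hσ₁₂c) (fun n => (hgen n).flow12) ki12 (kb12.mono fun t ht => ht.1)
        kl12
    · exact isArrivalFlow_of_setTendsto M hU
        (fun n => (hprod 2 (hS n).at210 (hm10 n) (hB10 n)).1)
        (fun n => (hprod 2 (hS n).at210 (hm10 n) (hB10 n)).2)
        (l2l 2) hτ₂₁ hσ₂₁ (hτc hσ₂₁c) (fun n => (hgen n).flow21) ki21 (kb21.mono fun t ht => ht.1)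
        kl21
    · exact fun t ht => tendsto_nhds_unique (hmass _ t ht)
        (((tendsto_const_nhds.sub (kl01.intervalIntegral ht)).sub (kl10.intervalIntegral ht)).congr
          fun n => ((hgen n).mass11 t ht).symm)
    · exact fun t ht => tendsto_nhds_unique (hmass _ t ht)
        (((kl01.intervalIntegral ht).sub (kl12.intervalIntegral ht)).congr
          fun n => ((hgen n).mass01 t ht).symm)
    · exact fun t ht => tendsto_nhds_unique (hmass _ t ht)
        (((kl10.intervalIntegral ht).sub (kl21.intervalIntegral ht)).congr
          fun n => ((hgen n).mass10 t ht).symm)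
    · exact fun t ht => tendsto_nhds_unique (hmass _ t ht)
        (((kl12.intervalIntegral ht).add (kl21.intervalIntegral ht)).congr
          fun n => ((hgen n).mass00 t ht).symm)

end Model

end ClosedGraph

/-! ### Compactness of the mass profiles and minimization -/

section Compactness

namespace Model

variable (M : Model)

/-- Compactness of the set of mass profiles (Arzelà–Ascoli). The limit is continuous on the whole
line, being extended by its values at `0` and `T`. -/
theorem exists_subseq_uniform {L : ℝ≥0} {ρ : ℕ → Label → ℝ → ℝ} (hρ : ∀ n, ρ n ∈ M.X L) :
    ∃ (ρ₀ : Label → ℝ → ℝ) (φ : ℕ → ℕ) (δ : ℕ → ℝ), StrictMono φ ∧ (∀ w, Continuous (ρ₀ w)) ∧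
      Tendsto δ atTop (𝓝 0) ∧ ∀ n w, ∀ t ∈ Icc 0 M.T, |ρ (φ n) w t - ρ₀ w t| ≤ δ n := by
  have hT := M.T_pos.le
  let R : ℝ := ∫ s in (0 : ℝ)..M.T, M.g s
  let A : Set (BoundedContinuousFunction (Icc 0 M.T) (Label → ℝ)) :=
    {f | (∀ x, f x ∈ Icc (0 : Label → ℝ) fun _ => R) ∧ ∀ x y, dist (f x) (f y) ≤ L * dist x y}
  have hA : IsCompact A := by
    refine BoundedContinuousFunction.arzela_ascoli₂ (Icc (0 : Label → ℝ) fun _ => R)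
      isCompact_Icc A ?_ (fun f x hf => hf.1 x) ?_
    · have hev : ∀ x : Icc 0 M.T, Continuous
          fun f : BoundedContinuousFunction (Icc 0 M.T) (Label → ℝ) => f x :=
        fun x => ContinuousEvalConst.continuous_eval_const x
      simp only [A, ofPred_and, ofPred_forall]
      exact (isClosed_iInter fun x => isClosed_Icc.preimage (hev x)).inter
        (isClosed_iInter fun x => isClosed_iInter fun y =>
          isClosed_le ((hev x).dist (hev y)) continuous_const)
    · exact (LipschitzWith.uniformEquicontinuous _ L fun f =>
        LipschitzWith.of_dist_le_mul f.2.2).equicontinuous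
  have hlip : ∀ n, LipschitzWith L fun x : Icc 0 M.T => fun w => ρ n w x := fun n =>
    LipschitzWith.of_dist_le_mul fun x y => (dist_pi_le_iff (by positivity)).2 fun w =>
      (hρ n w).1.dist_le_mul x x.2 y y.2
  let f : ℕ → BoundedContinuousFunction (Icc 0 M.T) (Label → ℝ) := fun n =>
    BoundedContinuousFunction.mkOfCompact ⟨fun x w => ρ n w x, (hlip n).continuous⟩
  have hf : ∀ n, f n ∈ A := fun n =>
    ⟨fun x => ⟨fun w => ((hρ n w).2 x x.2).1, fun w => ((hρ n w).2 x x.2).2⟩,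
      fun x y => (hlip n).dist_le_mul x y⟩
  obtain ⟨f₀, -, φ, hφ, hlim⟩ := hA.tendsto_subseq hf
  refine ⟨fun w t => f₀ (projIcc 0 M.T hT t) w, φ, fun n => dist (f (φ n)) f₀, hφ, fun w => ?_,
    tendsto_iff_dist_tendsto_zero.1 hlim, fun n w t ht => ?_⟩
  · exact (continuous_apply w).comp (f₀.continuous.comp continuous_projIcc)
  · beta_reduce
    rw [projIcc_of_mem hT ht]
    have h1 := (f (φ n)).dist_coe_le_dist (g := f₀) ⟨t, ht⟩
    exact (dist_le_pi_dist (f (φ n) ⟨t, ht⟩) (f₀ ⟨t, ht⟩) w).trans h1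

lemma uniformDist_le_iff {ρ ρ' : Label → ℝ → ℝ} {a : ℝ≥0∞} :
    M.uniformDist ρ ρ' ≤ a ↔ ∀ w, ∀ t ∈ Icc 0 M.T, ENNReal.ofReal |ρ w t - ρ' w t| ≤ a := by
  simp only [uniformDist, iSup_le_iff]

/-- The controller's cost attains its minimum over a compact set of parameters. -/
theorem exists_min_controllerCost (L : ℝ≥0) (ρbar : Label → ℝ → ℝ)
    {K : Set ((Label → ℝ) × (Label → ℝ))} (hK : IsCompact K) (hKne : K.Nonempty) :
    ∃ p ∈ K, ∀ q ∈ K, M.controllerCost L ρbar p.1 p.2 ≤ M.controllerCost L ρbar q.1 q.2 := by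
  set m : ℝ≥0∞ := ⨅ p ∈ K, M.controllerCost L ρbar p.1 p.2 with hm
  suffices h : ∃ p ∈ K, M.controllerCost L ρbar p.1 p.2 ≤ m from
    h.imp fun p hp => ⟨hp.1, fun q hq => hp.2.trans (iInf₂_le q hq)⟩
  rcases eq_or_ne m ⊤ with htop | hfin
  · obtain ⟨p, hp⟩ := hKne
    exact ⟨p, hp, htop ▸ le_top⟩
  -- a minimizing sequence of parameters and equilibria
  have hex : ∀ n : ℕ, ∃ p ∈ K, ∃ ρ ∈ M.equilibria L p.1 p.2,
      M.uniformDist ρ ρbar < m + ((n : ℝ≥0∞) + 1)⁻¹ := fun n => by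
    have hlt : m < m + ((n : ℝ≥0∞) + 1)⁻¹ := ENNReal.lt_add_right hfin (by simp)
    rw [hm] at hlt
    simp only [iInf_lt_iff, Model.controllerCost] at hlt
    obtain ⟨p, hp, ρ, hρ, hlt''⟩ := hlt
    exact ⟨p, hp, ρ, hρ, hlt''⟩
  choose p hpK ρ hρ hdist using hex
  obtain ⟨p₀, hp₀, φ, hφ, hpφ⟩ := hK.tendsto_subseq hpK
  obtain ⟨ρ₀, ψ, δ, hψ, hρ₀, hδ, hρδ⟩ := M.exists_subseq_uniform (L := L) (ρ := fun n => ρ (φ n))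
    fun n => (hρ (φ n)).choose_spec.1
  have hpψ := hpφ.comp hψ.tendsto_atTop
  have heq := M.mem_equilibria_of_tendsto ((continuous_fst.tendsto p₀).comp hpψ)
    ((continuous_snd.tendsto p₀).comp hpψ) (ρ := fun n => ρ (φ (ψ n))) (fun n => hρ (φ (ψ n)))
    hρ₀ hδ hρδ
  refine ⟨p₀, hp₀, (iInf₂_le ρ₀ heq).trans ?_⟩
  rw [M.uniformDist_le_iff]
  intro w t ht
  have h1 : Tendsto (fun n => ρ (φ (ψ n)) w t) atTop (𝓝 (ρ₀ w t)) :=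
    tendsto_iff_dist_tendsto_zero.2
      (squeeze_zero (fun _ => dist_nonneg) (fun n => hρδ n w t ht) hδ)
  have h2 := ENNReal.tendsto_ofReal (h1.sub_const (ρbar w t)).abs
  have h3 : Tendsto (fun n : ℕ => m + ((n : ℝ≥0∞) + 1)⁻¹) atTop (𝓝 m) := by
    have h4 := (tendsto_const_nhds (x := m)).add
      ((tendsto_add_atTop_iff_nat 1).2 ENNReal.tendsto_inv_nat_nhds_zero)
    simpa using h4
  refine le_of_tendsto_of_tendsto' h2 (h3.comp (hφ.comp hψ).tendsto_atTop) fun n => ?_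
  exact M.uniformDist_le_iff.1 (hdist (φ (ψ n))).le w t ht

end Model

end Compactness

end TouristFlow

theorem theorem2 (M : TouristFlow.Model) (L : NNReal)
    (ρbar : TouristFlow.Label → ℝ → ℝ) (hρbar : ρbar ∈ M.X L)
    (K : Set ((TouristFlow.Label → ℝ) × (TouristFlow.Label → ℝ)))
    (hK : IsCompact K) (hKne : K.Nonempty) :
    ∃ p ∈ K, ∀ q ∈ K,
      M.controllerCost L ρbar p.1 p.2 ≤ M.controllerCost L ρbar q.1 q.2 :=
  M.exists_min_controllerCost L ρbar hK hKne
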